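/- Let $(G,V,\|\cdot\|)$ be a sub-Finsler Lie group: $G$ is a (finite-dimensional, real) Lie group with Lie algebra $\mathfrak g$, $V\subseteq\mathfrak g$ is a linear subspace that generates $\mathfrak g$ as a Lie algebra, and $\|\cdot\|$ is a norm on $V$. Let $\mathrm E(v)=\tfrac12\|v\|^2$ be its energy; for $u\in V$ let $\partial_u\mathrm E=\{\eta\in V^*:\eta(v-u)\le \mathrm E(v)-\mathrm E(u)\ \forall v\in V\}$ be the subdifferential of $\mathrm E$ at $u$, and let $S^*(r)=\{\eta\in V^*:\|\eta\|_*=r\}$ be the sphere of radius $r$ for the dual norm $\|\eta\|_*=\sup\{\eta(v):\|v\|=1\}$. For an interval $I\subseteq\mathbb R$, a curve $\gamma:I\to G$ is called normal if it is (locally) absolutely continuous, if $\dot\gamma(t)=\mathrm dL_{\gamma(t)}u(t)$ for a.e. $t\in I$ with a control $u:I\to V$ that is square integrable on bounded subintervals of $I$, and if there is $\lambda\in\mathfrak g^*$ with $\lambda\circ\mathrm{Ad}_{\gamma(t)}|_V\in\partial_{u(t)}\mathrm E$ for a.e. $t\in I$. Suppose that there are $Y,X\in V$ such that the interior of $\partial_Y\mathrm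 E$ within $S^*(\|Y\|)$ is nonempty and such that $\{\mathrm{Ad}_{\exp(tY)}X: t\in\mathbb R\}$ is unbounded in $\mathfrak g$. Then there is branching of normal curves in $G$: there are an interval $I\subseteq\mathbb R$, two different normal curves $\gamma_1,\gamma_2:I\to G$, and a nondegenerate interval $J\subseteq I$ (i.e. one with more than one point) such that $\gamma_1|_J=\gamma_2|_J$. More precisely, there are $T>0$ and a family $(\gamma_\beta)_{\beta\in[0,T)}$ of pairwise different normal curves $\gamma_\beta:\mathbb R\to G$ such that $\gamma_\beta(t)=\exp(tY)$ for all $\beta\in[0,T)$ and all $t\in[0,T-\beta]$. -/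

import Mathlib

open Set MeasureTheory Topology
open scoped Manifold ContDiff

noncomputable section

namespace SubFinslerLie

section LieTheory

/-- A smooth real Lie group has the regularity over which Mathlib puts a Lie bracket on its
tangent space at the identity. -/
instance instLieGroupMinSmoothness {E : Type*} [NormedAddCommGroup E] [NormedSpace ℝ E]
    {G : Type*} [TopologicalSpace G] [ChartedSpace E G] [Group G] [LieGroup 𝓘(ℝ, E) ∞ G] :
    LieGroup 𝓘(ℝ, E) (minSmoothness ℝ 3) G := by
  rw [minSmoothness_of_isRCLikeNormedField]
  infer_instance

variable {E : Type*} [NormedAddCommGroup E] [NormedSpace ℝ E]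
  {G : Type*} [TopologicalSpace G] [ChartedSpace E G] [Group G]

/-- A left translate of an integral curve of a left-invariant vector field is again one. -/
theorem isMIntegralCurveOn_mul_left [LieGroup 𝓘(ℝ, E) ∞ G]
    {Y : GroupLieAlgebra 𝓘(ℝ, E) G} {c : ℝ → G} {s : Set ℝ}
    (hc : IsMIntegralCurveOn (I := 𝓘(ℝ, E)) c (mulInvariantVectorField Y) s) (g : G) :
    IsMIntegralCurveOn (I := 𝓘(ℝ, E)) (fun t => g * c t) (mulInvariantVectorField Y) s := by
  intro t ht
  have hmd : ∀ a b : G, MDifferentiableAt 𝓘(ℝ, E) 𝓘(ℝ, E) (fun x : G => a * x) b := fun a b =>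
    (contMDiff_mul_left (I := 𝓘(ℝ, E)) (n := ∞) (a := a)).mdifferentiableAt (by simp)
  have h := (hmd g (c t)).hasMFDerivAt.comp_hasMFDerivWithinAt t (hc t ht)
  have hfun : (fun x : G => g * c t * x) = (fun x => g * x) ∘ (fun x => c t * x) := by
    ext x; simp [mul_assoc]
  have key : mulInvariantVectorField (I := 𝓘(ℝ, E)) Y (g * c t)
      = mfderiv 𝓘(ℝ, E) 𝓘(ℝ, E) (fun x : G => g * x) (c t)
          (mulInvariantVectorField (I := 𝓘(ℝ, E)) Y (c t)) := by
    have e : (mfderiv 𝓘(ℝ, E) 𝓘(ℝ, E) (fun x : G => g * c t * x) 1 : E →L[ℝ] E)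
        = (mfderiv 𝓘(ℝ, E) 𝓘(ℝ, E) (fun x : G => g * x) (c t * 1) : E →L[ℝ] E).comp
          (mfderiv 𝓘(ℝ, E) 𝓘(ℝ, E) (fun x : G => c t * x) 1 : E →L[ℝ] E) := by
      rw [hfun]
      exact mfderiv_comp (I' := 𝓘(ℝ, E)) (1 : G) (hmd _ _) (hmd _ _)
    have e2 : ∀ z, z = c t → (mfderiv 𝓘(ℝ, E) 𝓘(ℝ, E) (fun x : G => g * x) z : E →L[ℝ] E)
        = mfderiv 𝓘(ℝ, E) 𝓘(ℝ, E) (fun x : G => g * x) (c t) := by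
      rintro _ rfl
      rfl
    rw [e2 _ (mul_one _)] at e
    exact congrArg (fun L : E →L[ℝ] E => L Y) e
  have h2 : (ContinuousLinearMap.smulRight (1 : ℝ →L[ℝ] ℝ)
        (mulInvariantVectorField (I := 𝓘(ℝ, E)) Y (g * c t)) : ℝ →L[ℝ] E)
      = (mfderiv 𝓘(ℝ, E) 𝓘(ℝ, E) (fun x : G => g * x) (c t)).comp
          (ContinuousLinearMap.smulRight (1 : ℝ →L[ℝ] ℝ)
            (mulInvariantVectorField (I := 𝓘(ℝ, E)) Y (c t))) := by
    refine ContinuousLinearMap.ext fun r => ?_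
    exact (congrArg (fun z : E => r • z) key).trans
      (map_smul (mfderiv 𝓘(ℝ, E) 𝓘(ℝ, E) (fun x : G => g * x) (c t)) r _).symm
  exact h2 ▸ h

/-- Left-invariant vector fields are complete. -/
theorem exists_integralCurve [LieGroup 𝓘(ℝ, E) ∞ G] [FiniteDimensional ℝ E]
    (Y : GroupLieAlgebra 𝓘(ℝ, E) G) :
    ∃ c : ℝ → G, c 0 = 1 ∧ IsMIntegralCurve (I := 𝓘(ℝ, E)) c (mulInvariantVectorField Y) := by
  have : CompleteSpace E := FiniteDimensional.complete ℝ E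
  have : IsTopologicalGroup G := topologicalGroup_of_lieGroup 𝓘(ℝ, E) ∞
  have : T1Space G := ChartedSpace.t1Space E G
  have : T2Space G := inferInstance
  have hv := contMDiff_mulInvariantVectorField (I := 𝓘(ℝ, E)) Y
  have hv1 := hv.of_le (m := 1) (by rw [minSmoothness_of_isRCLikeNormedField]; norm_num)
  obtain ⟨c, hc0, hc⟩ := exists_isMIntegralCurveAt_of_contMDiffAt_boundaryless (t₀ := 0)
    (hv1.contMDiffAt (x := (1 : G)))
  obtain ⟨ε, hε, hc⟩ := isMIntegralCurveAt_iff'.1 hc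
  refine exists_isMIntegralCurve_of_isMIntegralCurveOn hv1 hε (fun x => ⟨fun t => x * c t, ?_, ?_⟩) 1
  · simp [hc0]
  · rw [show Ioo (-ε) ε = Metric.ball (0 : ℝ) ε by simp [Real.ball_eq_Ioo]]
    exact isMIntegralCurveOn_mul_left hc x

/-- The exponential map: the value at time one of the integral curve, started at the identity,
of the left-invariant vector field generated by `Y`. -/
def lieExp [LieGroup 𝓘(ℝ, E) ∞ G] [FiniteDimensional ℝ E]
    (Y : GroupLieAlgebra 𝓘(ℝ, E) G) : G :=
  (exists_integralCurve Y).choose 1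

/-- The curve `t ↦ exp (t Y)` is the integral curve through the identity of the left-invariant
vector field generated by `Y`. -/
theorem eq_lieExp_smul [LieGroup 𝓘(ℝ, E) ∞ G] [FiniteDimensional ℝ E]
    {Y : GroupLieAlgebra 𝓘(ℝ, E) G}
    {c : ℝ → G} (hc0 : c 0 = 1)
    (hc : IsMIntegralCurve (I := 𝓘(ℝ, E)) c (mulInvariantVectorField Y)) (t : ℝ) :
    c t = lieExp (t • Y) := by
  have : CompleteSpace E := FiniteDimensional.complete ℝ E
  have : IsTopologicalGroup G := topologicalGroup_of_lieGroup 𝓘(ℝ, E) ∞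
  have : T1Space G := ChartedSpace.t1Space E G
  have : T2Space G := inferInstance
  have hv := contMDiff_mulInvariantVectorField (I := 𝓘(ℝ, E)) (t • Y)
  have hv1 := hv.of_le (m := 1) (by rw [minSmoothness_of_isRCLikeNormedField]; norm_num)
  obtain ⟨h0, h1⟩ := (exists_integralCurve (t • Y)).choose_spec
  have h2 := hc.comp_mul t
  rw [← mulInvariantVectorField_smul] at h2
  have := isMIntegralCurve_Ioo_eq_of_contMDiff_boundaryless (t₀ := 0) hv1 h2 h1 (by simp [h0, hc0])
  simpa [lieExp] using congrFun this 1

/-- The adjoint map `Ad g`: the differential at the identity of `h ↦ g h g⁻¹`, as an endomorphism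
of the Lie algebra. (The target of `mfderiv` is the tangent space at `g * 1 * g⁻¹ = 1`; in Mathlib
all tangent spaces are copies of the model space `E`.) -/
def Ad (g : G) : GroupLieAlgebra 𝓘(ℝ, E) G →L[ℝ] GroupLieAlgebra 𝓘(ℝ, E) G :=
  (mfderiv 𝓘(ℝ, E) 𝓘(ℝ, E) (fun h : G => g * h * g⁻¹) 1 : E →L[ℝ] E)

end LieTheory

section Curves

variable (E : Type*) [NormedAddCommGroup E] [NormedSpace ℝ E]
  {G : Type*} [TopologicalSpace G] [ChartedSpace E G]

/-- A curve in a manifold is (locally) absolutely continuous on the interval `I` if it is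
continuous on `I` and, read in charts, it is absolutely continuous on every compact subinterval
of `I` that it maps into a chart domain. -/
def IsAbsolutelyContinuousCurve (γ : ℝ → G) (I : Set ℝ) : Prop :=
  ContinuousOn γ I ∧
    ∀ (x : G) (a b : ℝ), a ≤ b → Icc a b ⊆ I → MapsTo γ (Icc a b) (chartAt E x).source →
      AbsolutelyContinuousOnInterval (fun t => chartAt E x (γ t)) a b

end Curves

section ConvexAnalysis

variable {W : Type*} [AddCommGroup W] [Module ℝ W] [TopologicalSpace W]

/-- The subdifferential of `f` at `u`: the set of covectors `η` with
`η (v - u) ≤ f v - f u` for all `v`. -/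
def subdifferential (f : W → ℝ) (u : W) : Set (W →L[ℝ] ℝ) :=
  {η | ∀ v, η (v - u) ≤ f v - f u}

/-- The energy of a (semi)norm. -/
def energy (N : Seminorm ℝ W) (v : W) : ℝ := (1 / 2) * N v ^ 2

/-- The dual norm `‖η‖_* = sup {η v | ‖v‖ = 1}`. -/
def dualNorm (N : Seminorm ℝ W) (η : W →L[ℝ] ℝ) : ℝ := sSup {r | ∃ v, N v = 1 ∧ η v = r}

/-- The sphere of radius `r`, centred at zero, for the dual norm. -/
def dualSphere (N : Seminorm ℝ W) (r : ℝ) : Set (W →L[ℝ] ℝ) := {η | dualNorm N η = r}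

/-- The interior of a set `A` of covectors within the dual sphere of radius `r`, that is, the
interior of `A ∩ S*(r)` for the topology that the dual space induces on `S*(r)`. -/
def interiorInDualSphere (N : Seminorm ℝ W) (r : ℝ) (A : Set (W →L[ℝ] ℝ)) :
    Set (dualSphere N r) :=
  interior (Subtype.val ⁻¹' A)

end ConvexAnalysis

/-- A sub-Finsler structure on a Lie group `G`: a bracket-generating linear subspace `V` of the
Lie algebra together with a norm on `V`. -/
structure SubFinsler (E : Type*) [NormedAddCommGroup E] [NormedSpace ℝ E] [FiniteDimensional ℝ E]
    (G : Type*) [TopologicalSpace G] [ChartedSpace E G] [Group G] [LieGroup 𝓘(ℝ, E) ∞ G] where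
  /-- the polarization -/
  V : Submodule ℝ (GroupLieAlgebra 𝓘(ℝ, E) G)
  bracketGenerating :
    haveI : CompleteSpace E := FiniteDimensional.complete ℝ E
    LieSubalgebra.lieSpan ℝ (GroupLieAlgebra 𝓘(ℝ, E) G)
      (V : Set (GroupLieAlgebra 𝓘(ℝ, E) G)) = ⊤
  /-- the norm on the polarization -/
  norm : Seminorm ℝ V
  eq_zero_of_norm_eq_zero : ∀ v : V, norm v = 0 → v = 0

namespace SubFinsler

variable {E : Type*} [NormedAddCommGroup E] [NormedSpace ℝ E] [FiniteDimensional ℝ E]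
  {G : Type*} [TopologicalSpace G] [ChartedSpace E G] [Group G] [LieGroup 𝓘(ℝ, E) ∞ G]

/-- The curve `γ` is horizontal on `I` with control `u`: it is absolutely continuous on `I` and
`γ' = dL_γ u` almost everywhere on `I`. -/
def IsHorizontalWithControl (S : SubFinsler E G) (γ : ℝ → G) (u : ℝ → S.V) (I : Set ℝ) : Prop :=
  IsAbsolutelyContinuousCurve E γ I ∧
    ∀ᵐ t ∂(volume.restrict I),
      HasMFDerivWithinAt 𝓘(ℝ, ℝ) 𝓘(ℝ, E) γ I t
        ((1 : ℝ →L[ℝ] ℝ).smulRight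
          (mulInvariantVectorField (u t : GroupLieAlgebra 𝓘(ℝ, E) G) (γ t)))

/-- The control `u` is square integrable on every bounded part of the interval `I`. (If `I` is
bounded this says that `u` is in `L²(I, V)`.) -/
def IsSquareIntegrableControl (S : SubFinsler E G) (u : ℝ → S.V) (I : Set ℝ) : Prop :=
  ∀ a b : ℝ, AEStronglyMeasurable u (volume.restrict (I ∩ Icc a b)) ∧
    MemLp (fun t => S.norm (u t)) 2 (volume.restrict (I ∩ Icc a b))

/-- `γ` is a normal curve on the interval `I`: it is horizontal with a square integrable control
`u`, and for some covector `λ` of the Lie algebra, `λ ∘ Ad_{γ(t)}` restricted to `V` belongs to the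
subdifferential of the energy at `u t` for almost every `t` in `I`. -/
def IsNormalCurve (S : SubFinsler E G) (γ : ℝ → G) (I : Set ℝ) : Prop :=
  ∃ u : ℝ → S.V, S.IsHorizontalWithControl γ u I ∧ S.IsSquareIntegrableControl u I ∧
    ∃ l : GroupLieAlgebra 𝓘(ℝ, E) G →L[ℝ] ℝ,
      ∀ᵐ t ∂(volume.restrict I),
        (l.comp (Ad (γ t))).comp S.V.subtypeL ∈ subdifferential (energy S.norm) (u t)

/-- Branching of normal curves: there are two different normal curves on an interval `I` that
coincide on a (nondegenerate) subinterval `J`. -/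
def HasBranchingOfNormalCurves (S : SubFinsler E G) : Prop :=
  ∃ (I J : Set ℝ) (γ₁ γ₂ : ℝ → G), I.OrdConnected ∧ J.OrdConnected ∧ J.Nontrivial ∧ J ⊆ I ∧
    S.IsNormalCurve γ₁ I ∧ S.IsNormalCurve γ₂ I ∧ EqOn γ₁ γ₂ J ∧ ¬ EqOn γ₁ γ₂ I

end SubFinsler

end SubFinslerLie

end

/-! Put `r = ‖Y‖` and, for a covector `l` of the Lie algebra, follow the costate `η(t) = l ∘
Ad_{γ(t)}` on `V`. A curve is normal as soon as its control maximises `η(t)` over the ball of radius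
`r` almost everywhere and `‖η(t)‖_* = r`; call a curve with maximising control an extremal.

That `∂_Y E` has interior in the dual sphere means that `Y` remains a maximiser for all covectors
near some `ξ₀ ≠ 0` (`exists_eventually_apply_eq_norm`). Hence, for every `l` whose restriction to
`V` is close to `ξ₀`, the line `exp(tY)` is an extremal for a short time.

Along any extremal `‖η‖` is constant (`norm_costate_eq`): the derivative of `Ad_γ u` in the
direction `u` vanishes, as `[u, u] = 0`, and `r‖η‖ - η(u)` is minimal where `u` is the velocity. So
`l(Ad_γ X)` is bounded along a global extremal. An arbitrarily small perturbation makes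
`l(Ad_{exp(tY)} X)` unbounded (`exists_covector_near`); a global extremal `γ` that begins as
`exp(tY)` must then leave this line.

Such a global extremal is built in `exists_isDevelopment_maximizing` as a limit of Euler polygons
whose feedback law selects `Y` whenever `Y` is a maximiser. The branching family is `exp(-βY) γ(t +
β)`. If two members agreed, `exp(-sY) γ(s)` would be periodic with period less than `T`, and being
`1` on `[0, T]` it would be `1` everywhere. -/

namespace SubFinslerLie

open Filter
open scoped Pointwise

/-! ### Left-trivialised derivatives and smoothness of the adjoint map -/

section LeftVelocity

variable {E : Type*} [NormedAddCommGroup E] [NormedSpace ℝ E]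
  {G : Type*} [TopologicalSpace G] [ChartedSpace E G] [Group G]

/-- The curve `c` has left-trivialised velocity `u` at `t` within `s`. -/
def HasLeftVelocityWithinAt (c : ℝ → G) (u : E) (s : Set ℝ) (t : ℝ) : Prop :=
  HasMFDerivWithinAt 𝓘(ℝ, ℝ) 𝓘(ℝ, E) c s t
    ((1 : ℝ →L[ℝ] ℝ).smulRight
      (mulInvariantVectorField (I := 𝓘(ℝ, E)) (u : GroupLieAlgebra 𝓘(ℝ, E) G) (c t)))

/-- The left-trivialised derivative of a vector-valued function on a Lie group. -/
noncomputable def leftDeriv {F : Type*} [NormedAddCommGroup F] [NormedSpace ℝ F]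
    (f : G → F) (x : G) : E →L[ℝ] F :=
  (mfderiv 𝓘(ℝ, E) 𝓘(ℝ, F) (fun h : G => f (x * h)) 1 : E →L[ℝ] F)

variable {F : Type*} [NormedAddCommGroup F] [NormedSpace ℝ F]

theorem leftDeriv_comp_mul_left (f : G → F) (g x : G) :
    leftDeriv (E := E) (fun y => f (g * y)) x = leftDeriv f (g * x) := by
  have h : (fun y : G => f (g * (x * y))) = fun y => f (g * x * y) := by simp only [mul_assoc]
  exact congrArg (β := E →L[ℝ] F) (fun φ : G → F => (mfderiv 𝓘(ℝ, E) 𝓘(ℝ, F) φ 1 : E →L[ℝ] F)) h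

theorem hasDerivWithinAt_of_comp_smulRight {f : ℝ → F} {L : E →L[ℝ] F} {v : E} {s : Set ℝ} {t : ℝ}
    (h : HasFDerivWithinAt f (L.comp ((1 : ℝ →L[ℝ] ℝ).smulRight v)) s t) :
    HasDerivWithinAt f (L v) s t := by
  simpa using h.hasDerivWithinAt

variable [LieGroup 𝓘(ℝ, E) ∞ G]

theorem mdifferentiableAt_mul_left (a b : G) :
    MDifferentiableAt 𝓘(ℝ, E) 𝓘(ℝ, E) (fun x : G => a * x) b :=
  (contMDiff_mul_left (I := 𝓘(ℝ, E)) (n := ∞) (a := a)).mdifferentiableAt (by simp)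

theorem leftDeriv_apply_eq_mfderiv {f : G → F} {x : G}
    (hf : MDifferentiableAt 𝓘(ℝ, E) 𝓘(ℝ, F) f x) (u : E) :
    leftDeriv f x u = (mfderiv 𝓘(ℝ, E) 𝓘(ℝ, F) f x : E →L[ℝ] F)
      (mulInvariantVectorField (I := 𝓘(ℝ, E)) (u : GroupLieAlgebra 𝓘(ℝ, E) G) x : E) := by
  have e : (mfderiv 𝓘(ℝ, E) 𝓘(ℝ, F) (fun h : G => f (x * h)) 1 : E →L[ℝ] F)
      = (mfderiv 𝓘(ℝ, E) 𝓘(ℝ, F) f (x * 1) : E →L[ℝ] F).comp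
        (mfderiv 𝓘(ℝ, E) 𝓘(ℝ, E) (fun h : G => x * h) 1 : E →L[ℝ] E) :=
    mfderiv_comp (I' := 𝓘(ℝ, E)) (1 : G) (by rwa [mul_one]) (mdifferentiableAt_mul_left _ _)
  have e2 : ∀ z, z = x → (mfderiv 𝓘(ℝ, E) 𝓘(ℝ, F) f z : E →L[ℝ] F)
      = mfderiv 𝓘(ℝ, E) 𝓘(ℝ, F) f x := by
    rintro _ rfl
    rfl
  rw [e2 _ (mul_one _)] at e
  exact congrArg (fun L : E →L[ℝ] F => L u) e

theorem HasLeftVelocityWithinAt.hasDerivWithinAt {c : ℝ → G} {u : E} {s : Set ℝ} {t : ℝ}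
    (hc : HasLeftVelocityWithinAt c u s t) {f : G → F}
    (hf : MDifferentiableAt 𝓘(ℝ, E) 𝓘(ℝ, F) f (c t)) :
    HasDerivWithinAt (fun τ => f (c τ)) (leftDeriv f (c t) u) s t := by
  have h := hf.hasMFDerivAt.comp_hasMFDerivWithinAt t hc
  rw [leftDeriv_apply_eq_mfderiv hf]
  exact hasDerivWithinAt_of_comp_smulRight (E := E) (F := F)
    (L := mfderiv 𝓘(ℝ, E) 𝓘(ℝ, F) f (c t))
    (v := mulInvariantVectorField (I := 𝓘(ℝ, E)) (u : GroupLieAlgebra 𝓘(ℝ, E) G) (c t)) (hasMFDerivWithinAt_iff_hasFDerivWithinAt.1 h)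

omit [LieGroup 𝓘(ℝ, E) ∞ G] in
theorem HasLeftVelocityWithinAt.congr_of_eventuallyEq {c c' : ℝ → G} {u : E} {s : Set ℝ} {t : ℝ}
    (hc : HasLeftVelocityWithinAt c u s t) (h : c' =ᶠ[𝓝[s] t] c) (ht : c' t = c t) :
    HasLeftVelocityWithinAt c' u s t := by
  unfold HasLeftVelocityWithinAt
  rw [ht]
  exact HasMFDerivWithinAt.congr_of_eventuallyEq hc h ht

theorem mulInvariantVectorField_mul_left (u : GroupLieAlgebra 𝓘(ℝ, E) G) (g x : G) :
    (mulInvariantVectorField (I := 𝓘(ℝ, E)) u (g * x) : E)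
      = (mfderiv 𝓘(ℝ, E) 𝓘(ℝ, E) (fun y : G => g * y) x : E →L[ℝ] E)
          (mulInvariantVectorField (I := 𝓘(ℝ, E)) u x : E) := by
  have hfun : (fun y : G => g * x * y) = (fun y => g * y) ∘ (fun y => x * y) := by
    ext y; simp [mul_assoc]
  have e : (mfderiv 𝓘(ℝ, E) 𝓘(ℝ, E) (fun y : G => g * x * y) 1 : E →L[ℝ] E)
      = (mfderiv 𝓘(ℝ, E) 𝓘(ℝ, E) (fun y : G => g * y) (x * 1) : E →L[ℝ] E).comp
        (mfderiv 𝓘(ℝ, E) 𝓘(ℝ, E) (fun y : G => x * y) 1 : E →L[ℝ] E) := by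
    rw [hfun]
    exact mfderiv_comp (I' := 𝓘(ℝ, E)) (1 : G) (mdifferentiableAt_mul_left _ _)
      (mdifferentiableAt_mul_left _ _)
  have e2 : ∀ z, z = x → (mfderiv 𝓘(ℝ, E) 𝓘(ℝ, E) (fun y : G => g * y) z : E →L[ℝ] E)
      = mfderiv 𝓘(ℝ, E) 𝓘(ℝ, E) (fun y : G => g * y) x := by
    rintro _ rfl
    rfl
  rw [e2 _ (mul_one _)] at e
  exact congrArg (fun L : E →L[ℝ] E => L u) e

theorem HasLeftVelocityWithinAt.mul_left {c : ℝ → G} {u : E} {s : Set ℝ} {t : ℝ}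
    (hc : HasLeftVelocityWithinAt c u s t) (g : G) :
    HasLeftVelocityWithinAt (fun τ => g * c τ) u s t := by
  have h := (mdifferentiableAt_mul_left g (c t)).hasMFDerivAt.comp_hasMFDerivWithinAt t hc
  have h2 : (ContinuousLinearMap.smulRight (1 : ℝ →L[ℝ] ℝ)
        (mulInvariantVectorField (I := 𝓘(ℝ, E)) (u : GroupLieAlgebra 𝓘(ℝ, E) G) (g * c t) : E) :
          ℝ →L[ℝ] E)
      = (mfderiv 𝓘(ℝ, E) 𝓘(ℝ, E) (fun x : G => g * x) (c t) : E →L[ℝ] E).comp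
          (ContinuousLinearMap.smulRight (1 : ℝ →L[ℝ] ℝ)
            (mulInvariantVectorField (I := 𝓘(ℝ, E)) (u : GroupLieAlgebra 𝓘(ℝ, E) G) (c t) : E)) := by
    refine ContinuousLinearMap.ext fun r => ?_
    exact (congrArg (fun z : E => r • z) (mulInvariantVectorField_mul_left u g (c t))).trans
      (map_smul (mfderiv 𝓘(ℝ, E) 𝓘(ℝ, E) (fun x : G => g * x) (c t) : E →L[ℝ] E) r _).symm
  unfold HasLeftVelocityWithinAt
  exact Eq.mpr (congrArg (fun L : ℝ →L[ℝ] E =>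
    HasMFDerivWithinAt 𝓘(ℝ, ℝ) 𝓘(ℝ, E) (fun τ => g * c τ) s t L) h2) h

/-- With a fixed base point in `G` and a vector space as target all coordinate changes are
identities, so that regularity of `mfderiv` in tangent coordinates is regularity of an
operator-valued map. -/
theorem inTangentCoordinates_const_left {N : Type*} (φ : N → E →L[ℝ] F) (b : N → F) (a : G)
    (x₀ x : N) :
    inTangentCoordinates 𝓘(ℝ, E) 𝓘(ℝ, F) (fun _ : N => a) b φ x₀ x = φ x := by
  have h := inTangentCoordinates_eq (I := 𝓘(ℝ, E)) (I' := 𝓘(ℝ, F)) (fun _ : N => a) b φ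
    (x₀ := x₀) (x := x) (mem_chart_source _ _) (mem_univ _)
  refine h.trans (ContinuousLinearMap.ext fun v => ?_)
  refine ((tangentBundleCore 𝓘(ℝ, F) F).coordChange_self (achart F (b x)) (b x)
    (mem_achart_source F (b x)) _).trans ?_
  exact congrArg (φ x) ((tangentBundleCore 𝓘(ℝ, E) G).coordChange_self (achart E a) a
    (mem_achart_source E a) v)

theorem inTangentCoordinates_const_const {N : Type*} (φ : N → E →L[ℝ] E) (a : G) (x₀ x : N) :
    inTangentCoordinates 𝓘(ℝ, E) 𝓘(ℝ, E) (fun _ : N => a) (fun _ : N => a) φ x₀ x = φ x := by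
  have h := inTangentCoordinates_eq (I := 𝓘(ℝ, E)) (I' := 𝓘(ℝ, E)) (fun _ : N => a)
    (fun _ : N => a) φ (x₀ := x₀) (x := x) (mem_chart_source _ _) (mem_chart_source _ _)
  refine h.trans (ContinuousLinearMap.ext fun v => ?_)
  refine ((tangentBundleCore 𝓘(ℝ, E) G).coordChange_self (achart E a) a
    (mem_achart_source E a) _).trans ?_
  exact congrArg (φ x) ((tangentBundleCore 𝓘(ℝ, E) G).coordChange_self (achart E a) a
    (mem_achart_source E a) v)

/-- The base point enters as a parameter of `h ↦ f (y * h)`, which is always differentiated at `1`;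
regularity of parametrised derivatives applies. -/
theorem continuousAt_leftDeriv {f : G → F} {x : G} (hf : ContMDiffAt 𝓘(ℝ, E) 𝓘(ℝ, F) ∞ f x) :
    ContinuousAt (leftDeriv (E := E) f) x := by
  have hu : ContMDiffAt (𝓘(ℝ, E).prod 𝓘(ℝ, E)) 𝓘(ℝ, F) ∞
      (Function.uncurry fun y h : G => f (y * h)) (x, 1) := by
    have hm : ContMDiffAt (𝓘(ℝ, E).prod 𝓘(ℝ, E)) 𝓘(ℝ, E) ∞ (fun p : G × G => p.1 * p.2) (x, 1) :=
      contMDiffAt_fst.mul contMDiffAt_snd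
    exact ContMDiffAt.comp (x, (1 : G)) (by simpa using hf) hm
  have h := ContMDiffAt.mfderiv (m := 0) (fun y h : G => f (y * h)) (fun _ => (1 : G)) hu
    contMDiffAt_const (by simp)
  refine h.continuousAt.congr (Eventually.of_forall fun y => ?_)
  exact inTangentCoordinates_const_left (leftDeriv f) (fun y => f (y * 1)) (1 : G) x y

/-- The adjoint map, as an endomorphism of the model space. -/
noncomputable def adModel (g : G) : E →L[ℝ] E := Ad g

theorem contMDiff_adModel :
    ContMDiff 𝓘(ℝ, E) 𝓘(ℝ, E →L[ℝ] E) ∞ (adModel (E := E) (G := G)) := by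
  intro x
  have hu : ContMDiffAt (𝓘(ℝ, E).prod 𝓘(ℝ, E)) 𝓘(ℝ, E) ∞
      (Function.uncurry fun y h : G => y * h * y⁻¹) (x, 1) :=
    (contMDiffAt_fst.mul contMDiffAt_snd).mul contMDiffAt_fst.inv
  have h := ContMDiffAt.mfderiv (m := ∞) (fun y h : G => y * h * y⁻¹) (fun _ => (1 : G)) hu
    contMDiffAt_const (by simp)
  refine h.congr_of_eventuallyEq (Eventually.of_forall fun y => ?_)
  have e : (fun y : G => y * 1 * y⁻¹) = fun _ => 1 := by ext; simp
  have := inTangentCoordinates_const_const (E := E) (adModel (G := G)) (1 : G) x y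
  refine this.symm.trans ?_
  exact congrArg (fun b : G → G => inTangentCoordinates 𝓘(ℝ, E) 𝓘(ℝ, E) (fun _ : G => (1 : G)) b
    (adModel (E := E) (G := G)) x y) e.symm

theorem adModel_mul (g h : G) :
    adModel (E := E) (g * h) = (adModel (E := E) g).comp (adModel (E := E) h) := by
  have hd : ∀ a b : G, MDifferentiableAt 𝓘(ℝ, E) 𝓘(ℝ, E) (fun y : G => a * y * a⁻¹) b := fun a b =>
    ((contMDiffAt_const.mul contMDiffAt_id).mul contMDiffAt_const
      : ContMDiffAt 𝓘(ℝ, E) 𝓘(ℝ, E) ∞ (fun y : G => a * y * a⁻¹) b).mdifferentiableAt (by simp)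
  have hfun : (fun y : G => g * h * y * (g * h)⁻¹) =
      (fun y => g * y * g⁻¹) ∘ (fun y => h * y * h⁻¹) := by
    ext y; simp [mul_assoc]
  have e : (mfderiv 𝓘(ℝ, E) 𝓘(ℝ, E) (fun y : G => g * h * y * (g * h)⁻¹) 1 : E →L[ℝ] E)
      = (mfderiv 𝓘(ℝ, E) 𝓘(ℝ, E) (fun y : G => g * y * g⁻¹) (h * 1 * h⁻¹) : E →L[ℝ] E).comp
        (mfderiv 𝓘(ℝ, E) 𝓘(ℝ, E) (fun y : G => h * y * h⁻¹) 1 : E →L[ℝ] E) := by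
    rw [hfun]
    exact mfderiv_comp (I' := 𝓘(ℝ, E)) (1 : G) (hd _ _) (hd _ _)
  have e2 : ∀ z, z = 1 → (mfderiv 𝓘(ℝ, E) 𝓘(ℝ, E) (fun y : G => g * y * g⁻¹) z : E →L[ℝ] E)
      = mfderiv 𝓘(ℝ, E) 𝓘(ℝ, E) (fun y : G => g * y * g⁻¹) 1 := by
    rintro _ rfl
    rfl
  rw [e2 _ (by simp)] at e
  exact e

omit [LieGroup 𝓘(ℝ, E) ∞ G] in
theorem adModel_one : adModel (1 : G) = ContinuousLinearMap.id ℝ E := by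
  have h : (fun y : G => 1 * y * 1⁻¹) = id := by ext; simp
  refine (congrArg (β := E →L[ℝ] E) (fun φ : G → G => (mfderiv 𝓘(ℝ, E) 𝓘(ℝ, E) φ 1 : E →L[ℝ] E)) h).trans ?_
  exact mfderiv_id

end LeftVelocity

/-! ### One-parameter subgroups -/

section ExpLine

variable {E : Type*} [NormedAddCommGroup E] [NormedSpace ℝ E] [FiniteDimensional ℝ E]
  {G : Type*} [TopologicalSpace G] [ChartedSpace E G] [Group G] [LieGroup 𝓘(ℝ, E) ∞ G]

variable (G) in
/-- The one-parameter subgroup generated by `Y`. -/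
noncomputable def expLine (Y : E) (t : ℝ) : G :=
  lieExp (t • (Y : GroupLieAlgebra 𝓘(ℝ, E) G))

theorem isMIntegralCurve_expLine (Y : E) :
    IsMIntegralCurve (I := 𝓘(ℝ, E)) (expLine G Y) (mulInvariantVectorField (I := 𝓘(ℝ, E))
      (Y : GroupLieAlgebra 𝓘(ℝ, E) G)) := by
  obtain ⟨c, hc0, hc⟩ := exists_integralCurve (E := E) (G := G) Y
  have : expLine G Y = c := funext fun t => (eq_lieExp_smul hc0 hc t).symm
  rwa [this]

theorem expLine_zero (Y : E) : expLine G Y 0 = 1 := by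
  obtain ⟨c, hc0, hc⟩ := exists_integralCurve (E := E) (G := G) Y
  rw [← show c 0 = expLine G Y 0 from eq_lieExp_smul hc0 hc 0, hc0]

theorem hasLeftVelocityWithinAt_expLine (Y : E) (s : Set ℝ) (t : ℝ) :
    HasLeftVelocityWithinAt (expLine G Y) Y s t :=
  (isMIntegralCurve_expLine (G := G) Y t).hasMFDerivWithinAt

theorem continuous_expLine (Y : E) : Continuous (expLine G Y) :=
  (isMIntegralCurve_expLine (G := G) Y).continuous

theorem expLine_add (Y : E) (s t : ℝ) :
    expLine G Y (s + t) = expLine G Y s * expLine G Y t := by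
  have h := isMIntegralCurveOn_mul_left
    (((isMIntegralCurve_expLine (G := G) Y).comp_add s).isMIntegralCurveOn univ) (expLine G Y s)⁻¹
  rw [← isMIntegralCurve_iff_isMIntegralCurveOn] at h
  have h2 := eq_lieExp_smul (by simp) h t
  change _ = expLine G Y t at h2
  rw [← h2]
  simp [add_comm]

/-- Conjugation by `exp(tY)` fixes the curve `s ↦ exp(sY)` pointwise; compare velocities at `s = 0`.
-/
theorem adModel_expLine_self (Y : E) (t : ℝ) :
    adModel (E := E) (expLine G Y t) Y = Y := by
  set g := expLine G Y t with hg
  have hκ : ∀ z : G, z = 1 → HasMFDerivAt 𝓘(ℝ, E) 𝓘(ℝ, E) (fun y : G => g * y * g⁻¹) z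
      (adModel (E := E) g) := by
    rintro _ rfl
    exact ((contMDiffAt_const.mul contMDiffAt_id).mul contMDiffAt_const : ContMDiffAt 𝓘(ℝ, E)
      𝓘(ℝ, E) ∞ (fun y : G => g * y * g⁻¹) 1).mdifferentiableAt (by simp) |>.hasMFDerivAt
  have hY : ∀ z : G, z = 1 → (mulInvariantVectorField (I := 𝓘(ℝ, E)) (Y : GroupLieAlgebra 𝓘(ℝ, E) G) z : E) = Y := by
    rintro _ rfl
    have h : (fun y : G => 1 * y) = id := by ext; simp
    have h2 : (mfderiv 𝓘(ℝ, E) 𝓘(ℝ, E) (fun y : G => 1 * y) 1 : E →L[ℝ] E)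
        = ContinuousLinearMap.id ℝ E :=
      (congrArg (β := E →L[ℝ] E) (fun φ : G → G => (mfderiv 𝓘(ℝ, E) 𝓘(ℝ, E) φ 1 : E →L[ℝ] E))
        h).trans mfderiv_id
    exact congrArg (fun L : E →L[ℝ] E => L Y) h2
  have h0 := isMIntegralCurve_expLine (G := G) Y 0
  have h1 := (hκ _ (expLine_zero Y)).comp 0 h0
  have hcomm : (fun y : G => g * y * g⁻¹) ∘ expLine G Y = expLine G Y := by
    ext s
    simp only [Function.comp_apply, hg]
    rw [← expLine_add, add_comm, expLine_add, mul_inv_cancel_right]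
  rw [hcomm] at h1
  have h2 : (adModel (E := E) g).comp ((1 : ℝ →L[ℝ] ℝ).smulRight
      (mulInvariantVectorField (I := 𝓘(ℝ, E)) (Y : GroupLieAlgebra 𝓘(ℝ, E) G) (expLine G Y 0) : E)) = (1 : ℝ →L[ℝ] ℝ).smulRight
      (mulInvariantVectorField (I := 𝓘(ℝ, E)) (Y : GroupLieAlgebra 𝓘(ℝ, E) G) (expLine G Y 0) : E) := hasMFDerivAt_unique h1 h0
  rw [hY _ (expLine_zero Y)] at h2
  have h3 : adModel (E := E) g ((1 : ℝ) • Y) = (1 : ℝ) • Y := congrArg (fun L : ℝ →L[ℝ] E => L 1) h2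
  rwa [one_smul] at h3

omit [FiniteDimensional ℝ E] in
theorem contMDiff_adModel_apply (v : E) :
    ContMDiff 𝓘(ℝ, E) 𝓘(ℝ, E) ∞ (fun x : G => adModel (E := E) x v) := by
  intro x
  exact (ContinuousLinearMap.apply ℝ E v).contMDiff.contMDiffAt.comp x (contMDiff_adModel x)

/-- This is `[v, v] = 0` in the form needed for the costate, obtained without the bracket: `Ad v` is
constant along `τ ↦ g exp(τv)`. -/
theorem leftDeriv_adModel_apply_self (v : E) (g : G) :
    leftDeriv (fun x : G => adModel (E := E) x v) g v = 0 := by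
  have h := ((hasLeftVelocityWithinAt_expLine (G := G) v univ 0).mul_left g).hasDerivWithinAt
    (f := fun x : G => adModel (E := E) x v)
    ((contMDiff_adModel_apply (G := G) v).mdifferentiableAt (by simp))
  have hc : (fun τ => adModel (E := E) (g * expLine G v τ) v)
      = fun _ => adModel (E := E) g v := by
    ext τ
    rw [adModel_mul, ContinuousLinearMap.comp_apply, adModel_expLine_self]
  rw [hc, expLine_zero, mul_one] at h
  exact (hasDerivWithinAt_univ.1 h).unique (hasDerivAt_const _ _)

end ExpLine

/-! ### Curves with bounded control: uniform estimates and compactness -/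

section Controlled

variable {E : Type*} [NormedAddCommGroup E] [NormedSpace ℝ E]
  {G : Type*} [TopologicalSpace G] [ChartedSpace E G] [Group G]
  {W : Type*} [NormedAddCommGroup W] [NormedSpace ℝ W]
  {F : Type*} [NormedAddCommGroup F] [NormedSpace ℝ F]

/-- The curve `c` in the group and the curve `w` in the control space are continuous and have
everywhere the right derivative given by the control `u`, which is bounded by `r`. -/
structure IsControlled (ι : W →L[ℝ] E) (r : ℝ) (c : ℝ → G) (w u : ℝ → W) : Prop where
  continuous_curve : Continuous c
  continuous_primitive : Continuous w
  velocity : ∀ t, HasLeftVelocityWithinAt c (ι (u t)) (Ici t) t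
  derivative : ∀ t, HasDerivWithinAt w (u t) (Ici t) t
  norm_le : ∀ t, ‖u t‖ ≤ r

variable {ι : W →L[ℝ] E} {r : ℝ} {c : ℝ → G} {w u : ℝ → W}

theorem IsControlled.norm_primitive_sub_le (h : IsControlled ι r c w u) (s t : ℝ) :
    ‖w t - w s‖ ≤ r * |t - s| := by
  wlog hst : s ≤ t generalizing s t
  · rw [norm_sub_rev, abs_sub_comm]
    exact this t s (le_of_not_ge hst)
  rw [abs_of_nonneg (sub_nonneg.2 hst)]
  exact norm_image_sub_le_of_norm_deriv_right_le_segment h.continuous_primitive.continuousOn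
    (fun x _ => h.derivative x) (fun x _ => h.norm_le x) t ⟨hst, le_rfl⟩

variable [LieGroup 𝓘(ℝ, E) ∞ G]

/-- The mean value inequality for `f ∘ c - A ∘ w`. It needs right derivatives only, hence holds
across the corners of polygons. -/
theorem IsControlled.norm_image_sub_sub_le (h : IsControlled ι r c w u) {f : G → F} {A : W →L[ℝ] F}
    {ε : ℝ} {s t : ℝ} (hf : ∀ τ ∈ uIcc s t, MDifferentiableAt 𝓘(ℝ, E) 𝓘(ℝ, F) f (c τ))
    (hε : ∀ τ ∈ uIcc s t, ‖leftDeriv f (c τ) (ι (u τ)) - A (u τ)‖ ≤ ε) :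
    ‖f (c t) - f (c s) - A (w t - w s)‖ ≤ ε * |t - s| := by
  wlog hst : s ≤ t generalizing s t
  · have := this (s := t) (t := s) (by rwa [uIcc_comm]) (by rwa [uIcc_comm]) (le_of_not_ge hst)
    rw [abs_sub_comm]
    refine le_of_eq_of_le ?_ this
    rw [← norm_neg]
    congr 1
    simp only [map_sub]
    abel
  rw [uIcc_of_le hst] at hf hε
  rw [abs_of_nonneg (sub_nonneg.2 hst)]
  have key := norm_image_sub_le_of_norm_deriv_right_le_segment
    (f := fun τ => f (c τ) - A (w τ)) (f' := fun τ => leftDeriv f (c τ) (ι (u τ)) - A (u τ))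
    (C := ε) (a := s) (b := t) ?_ ?_ (fun x hx => hε x (Ico_subset_Icc_self hx)) t ⟨hst, le_rfl⟩
  · refine le_of_eq_of_le ?_ key
    congr 1
    simp only [map_sub]
    abel
  · refine ContinuousOn.sub (fun x hx => ?_) (A.continuous.comp h.continuous_primitive).continuousOn
    exact ((hf x hx).continuousAt.comp h.continuous_curve.continuousAt).continuousWithinAt
  · intro x hx
    exact ((h.velocity x).hasDerivWithinAt (hf x (Ico_subset_Icc_self hx))).sub
      (A.hasFDerivAt.comp_hasDerivWithinAt x (h.derivative x))

theorem exists_norm_leftDeriv_le [T2Space G] {f : G → F} (hf : ContMDiff 𝓘(ℝ, E) 𝓘(ℝ, F) ∞ f)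
    (hc : HasCompactSupport f) : ∃ C, ∀ x, ‖leftDeriv (E := E) f x‖ ≤ C := by
  have : IsTopologicalGroup G := topologicalGroup_of_lieGroup 𝓘(ℝ, E) ∞
  have hcont : Continuous (leftDeriv (E := E) f) :=
    continuous_iff_continuousAt.2 fun x => continuousAt_leftDeriv (hf x)
  have hsupp : HasCompactSupport (leftDeriv (E := E) f) := by
    refine HasCompactSupport.intro hc fun x hx => ?_
    have h0 : (fun y : G => f (x * y)) =ᶠ[𝓝 1] fun _ => (0 : F) := by
      have h1 : Tendsto (fun y : G => x * y) (𝓝 1) (𝓝 x) := by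
        have : Continuous fun y : G => x * y := by fun_prop
        simpa using this.tendsto 1
      exact h1.eventually (notMem_tsupport_iff_eventuallyEq.1 hx)
    refine (h0.mfderiv_eq (I := 𝓘(ℝ, E)) (I' := 𝓘(ℝ, F))).trans ?_
    exact mfderiv_const
  exact hcont.bounded_above_of_compact_support hsupp

variable [FiniteDimensional ℝ E]

-- A bump function at `1` with support in `U`, translated to `c s`, changes at rate at most `M`
-- along `c`, so it cannot fall from `1` to `0` within time `1 / (M + 1)`. Left invariance makes the
-- bound independent of the curve and of `s`.
variable (ι r) in
theorem exists_forall_isControlled_mem {U : Set G} (hU : U ∈ 𝓝 (1 : G)) :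
    ∃ δ > 0, ∀ (c : ℝ → G) (w u : ℝ → W), IsControlled ι r c w u →
      ∀ s t, |t - s| < δ → (c s)⁻¹ * c t ∈ U := by
  have : IsTopologicalGroup G := topologicalGroup_of_lieGroup 𝓘(ℝ, E) ∞
  have : T1Space G := ChartedSpace.t1Space E G
  have : T2Space G := inferInstance
  obtain ⟨b, -, hb⟩ := (SmoothBumpFunction.nhds_basis_support (I := 𝓘(ℝ, E)) hU).mem_iff.1 hU
  obtain ⟨C, hC⟩ := exists_norm_leftDeriv_le (E := E) b.contMDiff b.hasCompactSupport
  have hC0 : 0 ≤ C := (norm_nonneg _).trans (hC 1)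
  set M := C * (‖ι‖ * |r|) with hM
  have hM0 : 0 ≤ M := by positivity
  refine ⟨1 / (M + 1), by positivity, fun c w u h s t hst => hb ?_⟩
  have hsm : ContMDiff 𝓘(ℝ, E) 𝓘(ℝ, ℝ) ∞ (fun y : G => b ((c s)⁻¹ * y)) :=
    b.contMDiff.comp contMDiff_mul_left
  have key := h.norm_image_sub_sub_le (f := fun y : G => b ((c s)⁻¹ * y)) (A := 0) (ε := M)
    (s := s) (t := t) (fun τ _ => (hsm _).mdifferentiableAt (by simp)) (fun τ _ => by
      rw [leftDeriv_comp_mul_left, zero_apply, sub_zero]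
      refine (ContinuousLinearMap.le_opNorm _ _).trans ?_
      refine mul_le_mul (hC _) ((ContinuousLinearMap.le_opNorm _ _).trans ?_) (norm_nonneg _) hC0
      exact mul_le_mul_of_nonneg_left ((h.norm_le τ).trans (le_abs_self r)) (norm_nonneg _))
  simp only [inv_mul_cancel, b.eq_one, zero_apply, sub_zero,
    Real.norm_eq_abs] at key
  intro h0
  rw [h0] at key
  have : M * |t - s| < 1 := by
    rw [lt_div_iff₀ (by positivity)] at hst
    nlinarith [abs_nonneg (t - s)]
  norm_num at key
  linarith

variable (ι r) in
theorem exists_isCompact_forall_isControlled_mem (t : ℝ) :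
    ∃ K : Set G, IsCompact K ∧ ∀ (c : ℝ → G) (w u : ℝ → W), IsControlled ι r c w u → c 0 = 1 →
      c t ∈ K := by
  have : IsTopologicalGroup G := topologicalGroup_of_lieGroup 𝓘(ℝ, E) ∞
  have : LocallyCompactSpace G := Manifold.locallyCompact_of_finiteDimensional 𝓘(ℝ, E)
  obtain ⟨K₀, hK₀, hK₀1⟩ := exists_compact_mem_nhds (1 : G)
  obtain ⟨δ, hδ, H⟩ := exists_forall_isControlled_mem ι r hK₀1
  have claim : ∀ k : ℕ, ∃ K : Set G, IsCompact K ∧ ∀ (c : ℝ → G) (w u : ℝ → W),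
      IsControlled ι r c w u → c 0 = 1 → ∀ t, |t| ≤ k * (δ / 2) → c t ∈ K := by
    intro k
    induction k with
    | zero =>
      refine ⟨{1}, isCompact_singleton, fun c w u _ h0 t ht => ?_⟩
      have : t = 0 := by simpa using ht
      simp [this, h0]
    | succ k ih =>
      obtain ⟨K, hK, hKc⟩ := ih
      refine ⟨K * K₀, hK.mul hK₀, fun c w u hc h0 t ht => ?_⟩
      push_cast at ht
      have hk : (0 : ℝ) < k + 1 := by positivity
      have h1 : |t / (k + 1)| ≤ δ / 2 := by
        rw [abs_div, abs_of_pos hk, div_le_iff₀ hk]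
        linarith
      -- Time `t` is cut into `k + 1` equal steps of length at most `δ / 2`; the last one
      -- contributes the factor in `K₀`.
      have h2 := hKc c w u hc h0 (k * (t / (k + 1))) (by
        rw [abs_mul, Nat.abs_cast]
        gcongr)
      have h3 := H c w u hc (k * (t / (k + 1))) t (by
        have : t - k * (t / (k + 1)) = t / (k + 1) := by field_simp; ring
        rw [this]
        linarith)
      simpa using mul_mem_mul h2 h3
  obtain ⟨k, hk⟩ := exists_nat_ge (|t| / (δ / 2))
  obtain ⟨K, hK, hKc⟩ := claim k
  exact ⟨K, hK, fun c w u hc h0 => hKc c w u hc h0 t ((div_le_iff₀ (by positivity)).1 hk)⟩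

end Controlled

/-! ### Developments as limits of controlled curves -/

section Development

universe v

variable {E : Type v} [NormedAddCommGroup E] [NormedSpace ℝ E]
  {G : Type*} [TopologicalSpace G] [ChartedSpace E G] [Group G]
  {W : Type*} [NormedAddCommGroup W] [NormedSpace ℝ W]

/-- The curve `γ` in the group is the development of the `r`-Lipschitz curve `w` in the control
space: smooth functions satisfy along it a strict first order expansion. -/
structure IsDevelopment (ι : W →L[ℝ] E) (r : ℝ) (γ : ℝ → G) (w : ℝ → W) : Prop where
  continuous : Continuous γ
  norm_sub_le : ∀ s t, ‖w t - w s‖ ≤ r * |t - s|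
  strict : ∀ (F : Type v) [NormedAddCommGroup F] [NormedSpace ℝ F] (f : G → F) (t₀ : ℝ),
    (∀ᶠ x in 𝓝 (γ t₀), ContMDiffAt 𝓘(ℝ, E) 𝓘(ℝ, F) ∞ f x) → ∀ ε > 0, ∃ δ > 0, ∀ s t,
      |s - t₀| < δ → |t - t₀| < δ →
        ‖f (γ t) - f (γ s) - leftDeriv f (γ t₀) (ι (w t - w s))‖ ≤ ε * |t - s|

section Limit

variable {ι : W →L[ℝ] E} {r : ℝ} {c : ℕ → ℝ → G} {w u : ℕ → ℝ → W}
  [LieGroup 𝓘(ℝ, E) ∞ G] [FiniteDimensional ℝ E]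

/-- An ultrafilter gives convergence at all times at once from compactness at each time, with no
extraction of subsequences. -/
theorem exists_tendsto_hyperfilter [FiniteDimensional ℝ W]
    (h : ∀ n, IsControlled ι r (c n) (w n) (u n)) (hc : ∀ n, c n 0 = 1) (hw : ∀ n, w n 0 = 0) :
    ∃ (γ : ℝ → G) (w' : ℝ → W), ∀ t,
      Tendsto (fun n => c n t) (hyperfilter ℕ) (𝓝 (γ t)) ∧
        Tendsto (fun n => w n t) (hyperfilter ℕ) (𝓝 (w' t)) := by
  have key : ∀ t, ∃ p : G × W, Tendsto (fun n => c n t) (hyperfilter ℕ) (𝓝 p.1) ∧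
      Tendsto (fun n => w n t) (hyperfilter ℕ) (𝓝 p.2) := by
    intro t
    obtain ⟨K, hK, hKc⟩ := exists_isCompact_forall_isControlled_mem (G := G) ι r t
    have : ProperSpace W := FiniteDimensional.proper ℝ W
    have hball : ∀ n, w n t ∈ Metric.closedBall (0 : W) (r * |t|) := fun n => by
      simpa [hw] using (h n).norm_primitive_sub_le 0 t
    obtain ⟨x, -, hx⟩ := hK.ultrafilter_le_nhds ((hyperfilter ℕ).map fun n => c n t)
      (tendsto_principal.2 (Eventually.of_forall fun n => hKc _ _ _ (h n) (hc n)))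
    obtain ⟨y, -, hy⟩ := (isCompact_closedBall (0 : W) (r * |t|)).ultrafilter_le_nhds
      ((hyperfilter ℕ).map fun n => w n t)
      (tendsto_principal.2 (Eventually.of_forall hball))
    exact ⟨(x, y), hx, hy⟩
  choose p hp using key
  exact ⟨fun t => (p t).1, fun t => (p t).2, hp⟩

variable {𝓤 : Filter ℕ} {γ : ℝ → G} {w' : ℝ → W}

theorem eventually_forall_mem_of_tendsto (h : ∀ n, IsControlled ι r (c n) (w n) (u n)) {t₀ : ℝ}
    (hγ : Tendsto (fun n => c n t₀) 𝓤 (𝓝 (γ t₀))) {O : Set G} (hO : O ∈ 𝓝 (γ t₀)) :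
    ∃ δ > 0, ∀ᶠ n in 𝓤, ∀ s, |s - t₀| < δ → c n s ∈ O := by
  have : IsTopologicalGroup G := topologicalGroup_of_lieGroup 𝓘(ℝ, E) ∞
  have hm : Tendsto (fun p : G × G => p.1 * p.2) (𝓝 (γ t₀) ×ˢ 𝓝 1) (𝓝 (γ t₀)) := by
    have := (continuous_mul (M := G)).tendsto (γ t₀, 1)
    rwa [nhds_prod_eq, mul_one] at this
  obtain ⟨A, hA, B, hB, hAB⟩ := mem_prod_iff.1 (hm hO)
  obtain ⟨δ, hδ, H⟩ := exists_forall_isControlled_mem ι r hB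
  refine ⟨δ, hδ, (hγ.eventually hA).mono fun n hn s hs => ?_⟩
  have := hAB (mk_mem_prod hn (H _ _ _ (h n) t₀ s hs))
  rwa [mem_preimage, mul_inv_cancel_left] at this

theorem continuous_of_tendsto [NeBot 𝓤] (h : ∀ n, IsControlled ι r (c n) (w n) (u n))
    (hγ : ∀ t, Tendsto (fun n => c n t) 𝓤 (𝓝 (γ t))) : Continuous γ := by
  have : IsTopologicalGroup G := topologicalGroup_of_lieGroup 𝓘(ℝ, E) ∞
  refine continuous_iff_continuousAt.2 fun t₀ => ?_
  refine tendsto_def.2 fun O hO => ?_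
  obtain ⟨C, hC, hCc, hCO⟩ := exists_mem_nhds_isClosed_subset hO
  obtain ⟨δ, hδ, H⟩ := eventually_forall_mem_of_tendsto h (hγ t₀) hC
  filter_upwards [Metric.ball_mem_nhds t₀ hδ] with s hs
  exact hCO (hCc.mem_of_tendsto (hγ s) (H.mono fun n hn => hn s hs))

/-- The controls need not converge, but the strict expansion involves only their primitives. It
holds for the approximations with `ε` and `δ` independent of `n`, thus survives pointwise limits. -/
theorem isDevelopment_of_tendsto [NeBot 𝓤] (h : ∀ n, IsControlled ι r (c n) (w n) (u n))
    (hγ : ∀ t, Tendsto (fun n => c n t) 𝓤 (𝓝 (γ t)))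
    (hw : ∀ t, Tendsto (fun n => w n t) 𝓤 (𝓝 (w' t))) : IsDevelopment ι r γ w' where
  continuous := continuous_of_tendsto h hγ
  norm_sub_le s t := le_of_tendsto ((hw t).sub (hw s)).norm
    (Eventually.of_forall fun n => (h n).norm_primitive_sub_le s t)
  strict F _ _ f t₀ hf ε hε := by
    set M := ‖ι‖ * |r| with hM
    have hM0 : 0 ≤ M := by positivity
    have hO : ∀ᶠ x in 𝓝 (γ t₀), ContMDiffAt 𝓘(ℝ, E) 𝓘(ℝ, F) ∞ f x ∧
        ‖leftDeriv (E := E) f x - leftDeriv f (γ t₀)‖ < ε / (M + 1) := by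
      have := (continuousAt_leftDeriv hf.self_of_nhds) (Metric.ball_mem_nhds _
        (show 0 < ε / (M + 1) by positivity))
      filter_upwards [hf, this] with x hx hx'
      exact ⟨hx, by simpa [dist_eq_norm] using hx'⟩
    obtain ⟨δ₁, hδ₁, H₁⟩ := eventually_forall_mem_of_tendsto h (hγ t₀) hO
    obtain ⟨δ₂, hδ₂, H₂⟩ := Metric.eventually_nhds_iff.1
      ((continuous_of_tendsto h hγ).continuousAt.eventually hO)
    refine ⟨min δ₁ δ₂, lt_min hδ₁ hδ₂, fun s t hs ht => ?_⟩
    have hlim : ∀ τ, |τ - t₀| < min δ₁ δ₂ → Tendsto (fun n => f (c n τ)) 𝓤 (𝓝 (f (γ τ))) :=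
      fun τ hτ => ((H₂ (show dist τ t₀ < δ₂ from hτ.trans_le (min_le_right _ _))).1.continuousAt
        |>.tendsto).comp (hγ τ)
    have hlin : Tendsto (fun n => leftDeriv f (γ t₀) (ι (w n t - w n s))) 𝓤
        (𝓝 (leftDeriv f (γ t₀) (ι (w' t - w' s)))) :=
      ((leftDeriv f (γ t₀)).continuous.comp ι.continuous).continuousAt.tendsto.comp
        ((hw t).sub (hw s))
    refine le_of_tendsto (((hlim t ht).sub (hlim s hs)).sub hlin).norm (H₁.mono fun n hn => ?_)
    have hmem : ∀ τ ∈ uIcc s t, |τ - t₀| < δ₁ := by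
      intro τ hτ
      have := (convex_ball t₀ (min δ₁ δ₂)).ordConnected.uIcc_subset (x := s) (y := t) hs ht hτ
      exact lt_of_lt_of_le this (min_le_left _ _)
    refine (h n).norm_image_sub_sub_le (f := f) (A := (leftDeriv f (γ t₀)).comp ι)
      (fun τ hτ => (hn τ (hmem τ hτ)).1.mdifferentiableAt (by simp)) (fun τ hτ => ?_)
    rw [ContinuousLinearMap.comp_apply, ← sub_apply]
    calc _ ≤ ‖leftDeriv f (c n τ) - leftDeriv f (γ t₀)‖ * ‖ι (u n τ)‖ :=
          ContinuousLinearMap.le_opNorm _ _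
      _ ≤ ε / (M + 1) * M := by
          refine mul_le_mul (hn τ (hmem τ hτ)).2.le ?_ (norm_nonneg _) (by positivity)
          exact (ContinuousLinearMap.le_opNorm _ _).trans
            (mul_le_mul_of_nonneg_left (((h n).norm_le τ).trans (le_abs_self r)) (norm_nonneg _))
      _ ≤ ε := by
          rw [div_mul_eq_mul_div, div_le_iff₀ (by positivity)]
          nlinarith

end Limit

namespace IsDevelopment

variable {ι : W →L[ℝ] E} {r : ℝ} {γ : ℝ → G} {w : ℝ → W} (h : IsDevelopment ι r γ w)
include h

theorem lipschitzWith : LipschitzWith r.toNNReal w := by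
  refine LipschitzWith.of_dist_le_mul fun t s => ?_
  rw [dist_eq_norm, Real.dist_eq]
  exact (h.norm_sub_le s t).trans (mul_le_mul_of_nonneg_right (Real.le_coe_toNNReal r) (abs_nonneg _))

theorem exists_lipschitzOnWith {F : Type v} [NormedAddCommGroup F] [NormedSpace ℝ F] {f : G → F}
    {t₀ : ℝ} (hf : ∀ᶠ x in 𝓝 (γ t₀), ContMDiffAt 𝓘(ℝ, E) 𝓘(ℝ, F) ∞ f x) :
    ∃ K, ∃ T ∈ 𝓝 t₀, LipschitzOnWith K (fun t => f (γ t)) T := by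
  obtain ⟨δ, hδ, H⟩ := h.strict F f t₀ hf 1 one_pos
  set A := (leftDeriv f (γ t₀)).comp ι
  refine ⟨(1 + ‖A‖ * |r|).toNNReal, Metric.ball t₀ δ, Metric.ball_mem_nhds _ hδ,
    LipschitzOnWith.of_dist_le_mul fun t ht s hs => ?_⟩
  rw [dist_eq_norm, Real.dist_eq, Real.coe_toNNReal _ (by positivity)]
  have h1 : ‖A (w t - w s)‖ ≤ ‖A‖ * (|r| * |t - s|) :=
    (A.le_opNorm _).trans (mul_le_mul_of_nonneg_left ((h.norm_sub_le s t).trans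
      (mul_le_mul_of_nonneg_right (le_abs_self r) (abs_nonneg _))) (norm_nonneg _))
  have h2 : ‖f (γ t) - f (γ s) - A (w t - w s)‖ ≤ 1 * |t - s| := H s t hs ht
  have h3 := norm_le_norm_sub_add (f (γ t) - f (γ s)) (A (w t - w s))
  linarith

theorem hasDerivAt {F : Type v} [NormedAddCommGroup F] [NormedSpace ℝ F] {f : G → F}
    {t₀ : ℝ} (hf : ∀ᶠ x in 𝓝 (γ t₀), ContMDiffAt 𝓘(ℝ, E) 𝓘(ℝ, F) ∞ f x) {u : W}
    (hw : HasDerivAt w u t₀) : HasDerivAt (fun t => f (γ t)) (leftDeriv f (γ t₀) (ι u)) t₀ := by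
  have h1 : HasDerivAt (fun t => leftDeriv f (γ t₀) (ι (w t))) (leftDeriv f (γ t₀) (ι u)) t₀ :=
    ((leftDeriv f (γ t₀)).comp ι).hasFDerivAt.comp_hasDerivAt t₀ hw
  have h2 : HasDerivAt (fun t => f (γ t) - leftDeriv f (γ t₀) (ι (w t))) 0 t₀ := by
    rw [hasDerivAt_iff_isLittleO, Asymptotics.isLittleO_iff]
    intro ε hε
    obtain ⟨δ, hδ, H⟩ := h.strict F f t₀ hf ε hε
    filter_upwards [Metric.ball_mem_nhds t₀ hδ] with t ht
    have := H t₀ t (by simpa using hδ) ht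
    simp only [map_sub] at this
    rw [smul_zero, sub_zero]
    refine le_of_eq_of_le ?_ this
    congr 1
    abel
  refine ((h2.add h1).congr_deriv (zero_add _)).congr_of_eventuallyEq (Eventually.of_forall fun t => ?_)
  simp

variable [LieGroup 𝓘(ℝ, E) ∞ G]

theorem isAbsolutelyContinuousCurve (I : Set ℝ) : IsAbsolutelyContinuousCurve E γ I := by
  refine ⟨h.continuous.continuousOn, fun x a b hab _ hmaps => ?_⟩
  have hloc : LocallyLipschitzOn (Icc a b) (fun t => chartAt E x (γ t)) := by
    intro t ht
    have hx : ∀ᶠ y in 𝓝 (γ t), ContMDiffAt 𝓘(ℝ, E) 𝓘(ℝ, E) ∞ (extChartAt 𝓘(ℝ, E) x) y := by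
      filter_upwards [(chartAt E x).open_source.mem_nhds (hmaps ht)] with y hy
      exact contMDiffAt_extChartAt' hy
    obtain ⟨K, T, hT, hK⟩ := h.exists_lipschitzOnWith hx
    exact ⟨K, T, mem_nhdsWithin_of_mem_nhds hT, hK⟩
  obtain ⟨K, hK⟩ := hloc.exists_lipschitzOnWith_of_compact isCompact_Icc
  rw [← uIcc_of_le hab] at hK
  exact hK.absolutelyContinuousOnInterval

theorem hasLeftVelocityWithinAt {t : ℝ} {u : W} (hw : HasDerivAt w u t) (I : Set ℝ) :
    HasLeftVelocityWithinAt γ (ι u) I t := by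
  have hx : ∀ᶠ y in 𝓝 (γ t), ContMDiffAt 𝓘(ℝ, E) 𝓘(ℝ, E) ∞ (extChartAt 𝓘(ℝ, E) (γ t)) y := by
    filter_upwards [(chartAt E (γ t)).open_source.mem_nhds (mem_chart_source E _)] with y hy
    exact contMDiffAt_extChartAt' hy
  have h1 := h.hasDerivAt hx hw
  rw [leftDeriv_apply_eq_mfderiv (hx.self_of_nhds.mdifferentiableAt (by simp))] at h1
  have h2 : (mfderiv 𝓘(ℝ, E) 𝓘(ℝ, E) (extChartAt 𝓘(ℝ, E) (γ t)) (γ t) : E →L[ℝ] E)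
      = ContinuousLinearMap.id ℝ E := mfderiv_extChartAt_self
  have h3 := h1.congr_deriv (congrArg (fun L : E →L[ℝ] E => L
    (mulInvariantVectorField (I := 𝓘(ℝ, E)) (ι u : GroupLieAlgebra 𝓘(ℝ, E) G) (γ t) : E)) h2)
  exact ⟨h.continuous.continuousWithinAt, h3.hasFDerivAt.hasFDerivWithinAt⟩

end IsDevelopment

end Development

/-! ### Gluing along a grid, and Euler polygons -/

section Piecewise

/-- The function that equals `P m` on the `m`-th interval of length `δ`. -/
noncomputable def piecewiseOnGrid {X : Type*} (δ : ℝ) (P : ℤ → ℝ → X) (t : ℝ) : X := P ⌊t / δ⌋ t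

variable {X : Type*} {δ : ℝ} {P : ℤ → ℝ → X}

theorem piecewiseOnGrid_eq (hδ : 0 < δ) (hP : ∀ m : ℤ, P m ((m + 1) * δ) = P (m + 1) ((m + 1) * δ))
    {m : ℤ} {t : ℝ} (h1 : m * δ ≤ t) (h2 : t ≤ (m + 1) * δ) : piecewiseOnGrid δ P t = P m t := by
  unfold piecewiseOnGrid
  rcases h2.lt_or_eq with h2 | rfl
  · rw [Int.floor_eq_iff.2 ⟨(le_div_iff₀ hδ).2 h1, (div_lt_iff₀ hδ).2 h2⟩]
  · rw [mul_div_assoc, div_self hδ.ne', mul_one, ← Int.cast_one, ← Int.cast_add, Int.floor_intCast]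
    push_cast
    exact (hP m).symm

theorem floor_div_mul_le (hδ : 0 < δ) (t : ℝ) : (⌊t / δ⌋ : ℝ) * δ ≤ t :=
  (le_div_iff₀ hδ).1 (Int.floor_le _)

theorem lt_floor_div_add_one_mul (hδ : 0 < δ) (t : ℝ) : t < ((⌊t / δ⌋ : ℝ) + 1) * δ :=
  (div_lt_iff₀ hδ).1 (Int.lt_floor_add_one _)

theorem piecewiseOnGrid_eventuallyEq (hδ : 0 < δ)
    (hP : ∀ m : ℤ, P m ((m + 1) * δ) = P (m + 1) ((m + 1) * δ)) (t : ℝ) :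
    piecewiseOnGrid δ P =ᶠ[𝓝[≥] t] P ⌊t / δ⌋ := by
  filter_upwards [Icc_mem_nhdsGE (lt_floor_div_add_one_mul hδ t)] with s hs
  exact piecewiseOnGrid_eq hδ hP ((floor_div_mul_le hδ t).trans hs.1) hs.2

theorem continuous_piecewiseOnGrid [TopologicalSpace X] (hδ : 0 < δ) (hc : ∀ m, Continuous (P m))
    (hP : ∀ m : ℤ, P m ((m + 1) * δ) = P (m + 1) ((m + 1) * δ)) :
    Continuous (piecewiseOnGrid δ P) := by
  refine continuous_iff_continuousAt.2 fun t => continuousAt_iff_continuous_left_right.2 ⟨?_, ?_⟩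
  -- At a grid point this is the interval that ends at `t`, where the floor would give the one that
  -- starts there.
  · set m := ⌈t / δ⌉ - 1 with hm
    have h1 : (m : ℝ) * δ < t := by
      rw [← lt_div_iff₀ hδ, hm]
      push_cast
      linarith [Int.ceil_lt_add_one (t / δ)]
    have h2 : t ≤ ((m : ℝ) + 1) * δ := by
      rw [← div_le_iff₀ hδ, hm]
      push_cast
      linarith [Int.le_ceil (t / δ)]
    refine (hc m).continuousWithinAt.congr_of_eventuallyEq ?_ (piecewiseOnGrid_eq hδ hP h1.le h2)
    filter_upwards [Icc_mem_nhdsLE h1] with s hs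
    exact piecewiseOnGrid_eq hδ hP hs.1 (hs.2.trans h2)
  · exact (hc _).continuousWithinAt.congr_of_eventuallyEq (piecewiseOnGrid_eventuallyEq hδ hP t) rfl

end Piecewise

theorem exists_int_forall_add_one_eq_add {A : Type*} [AddCommGroup A] (s : ℤ → A) :
    ∃ q : ℤ → A, q 0 = 0 ∧ ∀ m, q (m + 1) = q m + s m := by
  refine ⟨fun m => match m with
    | Int.ofNat n => ∑ i ∈ Finset.range n, s i
    | Int.negSucc n => -∑ i ∈ Finset.range (n + 1), s (Int.negSucc i), by rfl, fun m => ?_⟩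
  match m with
  | Int.ofNat n => exact Finset.sum_range_succ (fun i : ℕ => s i) n
  | Int.negSucc 0 => simp
  | Int.negSucc (n + 1) =>
    have : Int.negSucc (n + 1) + 1 = Int.negSucc n := by omega
    rw [this]
    change -∑ i ∈ Finset.range (n + 1), s (Int.negSucc i)
      = -∑ i ∈ Finset.range (n + 2), s (Int.negSucc i) + s (Int.negSucc (n + 1))
    rw [Finset.sum_range_succ _ (n + 1)]
    simp

section Polygon

variable {E : Type*} [NormedAddCommGroup E] [NormedSpace ℝ E] [FiniteDimensional ℝ E]
  {G : Type*} [TopologicalSpace G] [ChartedSpace E G] [Group G] [LieGroup 𝓘(ℝ, E) ∞ G]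
  {W : Type*} [NormedAddCommGroup W] [NormedSpace ℝ W]

/-- Forward in time the feedback is read at the left node, backward at the right one, so that each
step is explicit. The left node on `m ≥ 0` lets the polygon follow `exp(tY)`. -/
theorem exists_int_feedback (ι : W →L[ℝ] E) (σ : G → W) (δ : ℝ) :
    ∃ (p : ℤ → G) (v : ℤ → W), p 0 = 1 ∧ (∀ m, p (m + 1) = p m * expLine G (ι (v m)) δ) ∧
      (∀ m, 0 ≤ m → v m = σ (p m)) ∧ ∀ m, v m = σ (p m) ∨ v m = σ (p (m + 1)) := by
  let fp : ℕ → G := fun n => Nat.rec 1 (fun _ g => g * expLine G (ι (σ g)) δ) n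
  let fm : ℕ → G := fun n => Nat.rec 1 (fun _ g => g * (expLine G (ι (σ g)) δ)⁻¹) n
  let p : ℤ → G := fun m => match m with
    | Int.ofNat n => fp n
    | Int.negSucc n => fm (n + 1)
  let v : ℤ → W := fun m => match m with
    | Int.ofNat n => σ (fp n)
    | Int.negSucc n => σ (fm n)
  have hneg : ∀ n : ℕ, p (Int.negSucc n + 1) = fm n := by
    intro n
    match n with
    | 0 => rfl
    | n + 1 =>
      have : Int.negSucc (n + 1) + 1 = Int.negSucc n := by omega
      rw [this]
  refine ⟨p, v, rfl, fun m => ?_, fun m hm => ?_, fun m => ?_⟩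
  · match m with
    | Int.ofNat n => rfl
    | Int.negSucc n =>
      rw [hneg]
      change fm n = fm n * (expLine G (ι (σ (fm n))) δ)⁻¹ * expLine G (ι (σ (fm n))) δ
      rw [inv_mul_cancel_right]
  · match m, hm with
    | Int.ofNat n, _ => rfl
  · match m with
    | Int.ofNat n => exact Or.inl rfl
    | Int.negSucc n =>
      rw [hneg]
      exact Or.inr rfl

/-- Euler polygons for the feedback law `σ`. -/
theorem exists_isControlled_of_feedback (ι : W →L[ℝ] E) {r : ℝ} {σ : G → W} (hσ : ∀ g, ‖σ g‖ ≤ r)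
    {δ : ℝ} (hδ : 0 < δ) :
    ∃ (c : ℝ → G) (w u : ℝ → W), IsControlled ι r c w u ∧ c 0 = 1 ∧ w 0 = 0 ∧
      (∀ t, ∃ τ, |τ - t| ≤ δ ∧ u t = σ (c τ)) ∧
      ∀ (Y : W) (T : ℝ), (∀ t ∈ Icc 0 T, σ (expLine G (ι Y) t) = Y) →
        ∀ t ∈ Icc 0 T, c t = expLine G (ι Y) t := by
  obtain ⟨p, v, hp0, hp, hv0, hv⟩ := exists_int_feedback ι σ δ
  obtain ⟨q, hq0, hq⟩ := exists_int_forall_add_one_eq_add fun m => δ • v m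
  set P : ℤ → ℝ → G := fun m t => p m * expLine G (ι (v m)) (t - m * δ) with hPdef
  set Q : ℤ → ℝ → W := fun m t => q m + (t - m * δ) • v m with hQdef
  have hP : ∀ m : ℤ, P m ((m + 1) * δ) = P (m + 1) ((m + 1) * δ) := by
    intro m
    have h1 : ((m : ℝ) + 1) * δ - m * δ = δ := by ring
    simp only [hPdef, h1, hp]
    push_cast
    rw [sub_self, expLine_zero, mul_one]
  have hQ : ∀ m : ℤ, Q m ((m + 1) * δ) = Q (m + 1) ((m + 1) * δ) := by
    intro m
    have h1 : ((m : ℝ) + 1) * δ - m * δ = δ := by ring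
    simp only [hQdef, h1, hq]
    push_cast
    rw [sub_self, zero_smul, add_zero]
  have : IsTopologicalGroup G := topologicalGroup_of_lieGroup 𝓘(ℝ, E) ∞
  have hPc : ∀ m, Continuous (P m) := fun m =>
    continuous_const.mul ((continuous_expLine _).comp (continuous_id.sub continuous_const))
  have hQc : ∀ m, Continuous (Q m) := fun m => by
    simp only [hQdef]
    fun_prop
  have hPm : ∀ m : ℤ, piecewiseOnGrid δ P (m * δ) = p m := fun m => by
    rw [piecewiseOnGrid_eq hδ hP le_rfl (by linarith)]
    simp only [hPdef]
    rw [sub_self, expLine_zero, mul_one]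
  refine ⟨piecewiseOnGrid δ P, piecewiseOnGrid δ Q, fun t => v ⌊t / δ⌋,
    ⟨continuous_piecewiseOnGrid hδ hPc hP, continuous_piecewiseOnGrid hδ hQc hQ, fun t => ?_,
      fun t => ?_, fun t => ?_⟩, ?_, ?_, fun t => ?_, fun Y T hY t ht => ?_⟩
  · have h1 : IsMIntegralCurve (I := 𝓘(ℝ, E)) (fun s => expLine G (ι (v ⌊t / δ⌋)) (s - ⌊t / δ⌋ * δ))
        (mulInvariantVectorField (I := 𝓘(ℝ, E)) (ι (v ⌊t / δ⌋) : GroupLieAlgebra 𝓘(ℝ, E) G)) := by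
      simpa [Function.comp_def, sub_eq_add_neg] using
        (isMIntegralCurve_expLine (G := G) (ι (v ⌊t / δ⌋))).comp_add (-(⌊t / δ⌋ * δ))
    have h2 : HasLeftVelocityWithinAt (P ⌊t / δ⌋) (ι (v ⌊t / δ⌋)) (Ici t) t :=
      HasLeftVelocityWithinAt.mul_left (h1 t).hasMFDerivWithinAt (p ⌊t / δ⌋)
    exact h2.congr_of_eventuallyEq (piecewiseOnGrid_eventuallyEq hδ hP t) rfl
  · have h1 : HasDerivWithinAt (Q ⌊t / δ⌋) (v ⌊t / δ⌋) (Ici t) t := by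
      have := (((hasDerivAt_id t).sub_const (⌊t / δ⌋ * δ)).smul_const (v ⌊t / δ⌋)).const_add
        (q ⌊t / δ⌋)
      rw [one_smul] at this
      exact this.hasDerivWithinAt
    exact h1.congr_of_eventuallyEq (piecewiseOnGrid_eventuallyEq hδ hQ t) rfl
  · rcases hv ⌊t / δ⌋ with h | h <;> rw [h] <;> exact hσ _
  · simpa [hp0] using hPm 0
  · have := piecewiseOnGrid_eq hδ hQ (m := 0) (t := 0) (by simp) (by simpa using hδ.le)
    rw [this]
    simp [hQdef, hq0]
  · have h1 := floor_div_mul_le hδ t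
    have h2 := lt_floor_div_add_one_mul hδ t
    rcases hv ⌊t / δ⌋ with h | h
    · refine ⟨⌊t / δ⌋ * δ, ?_, by simp only [hPm, h]⟩
      rw [abs_le]
      constructor <;> linarith
    · refine ⟨(⌊t / δ⌋ + 1 : ℤ) * δ, ?_, by simp only [hPm, h]⟩
      push_cast
      rw [abs_le]
      constructor <;> linarith
  · have hnode : ∀ k : ℕ, k * δ ≤ T → p k = expLine G (ι Y) (k * δ) := by
      intro k
      induction k with
      | zero => simp [hp0, expLine_zero]
      | succ k ih =>
        intro hk
        push_cast at hk ⊢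
        have hk' : (k : ℝ) * δ ≤ T := by linarith
        rw [hp, hv0 _ (by positivity), ih hk', hY _ ⟨by positivity, hk'⟩, ← expLine_add]
        congr 1
        ring
    have h1 := floor_div_mul_le hδ t
    obtain ⟨k, hk⟩ := Int.eq_ofNat_of_zero_le (Int.floor_nonneg.2 (div_nonneg ht.1 hδ.le))
    unfold piecewiseOnGrid
    rw [hk] at h1 ⊢
    simp only [Int.cast_natCast] at h1
    have hkT : (k : ℝ) * δ ≤ T := h1.trans ht.2
    simp only [hPdef, Int.cast_natCast]
    rw [hv0 _ (by positivity), hnode k hkT, hY _ ⟨by positivity, hkT⟩, ← expLine_add]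
    congr 1
    ring

end Polygon

theorem exists_norm_le_and_apply_eq {W : Type*} [NormedAddCommGroup W] [NormedSpace ℝ W]
    [FiniteDimensional ℝ W] {r : ℝ} (hr : 0 < r) (η : W →L[ℝ] ℝ) :
    ∃ v, ‖v‖ ≤ r ∧ η v = r * ‖η‖ := by
  have : ProperSpace W := FiniteDimensional.proper ℝ W
  obtain ⟨v, hv, hmax⟩ := (isCompact_closedBall (0 : W) r).exists_isMaxOn
    ⟨0, by simpa using hr.le⟩ η.continuous.continuousOn
  have hv : ‖v‖ ≤ r := by simpa using hv
  have hle : ∀ x, ‖x‖ ≤ r → η x ≤ η v := fun x hx => hmax (by simpa using hx)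
  have h0 : 0 ≤ η v := by simpa using hle 0 (by simpa using hr.le)
  refine ⟨v, hv, le_antisymm ?_ ?_⟩
  · calc η v ≤ ‖η v‖ := le_abs_self _
      _ ≤ ‖η‖ * ‖v‖ := η.le_opNorm v
      _ ≤ r * ‖η‖ := by rw [mul_comm]; gcongr
  · rw [← le_div_iff₀' hr]
    have hle' : ∀ x, η x ≤ η v / r * ‖x‖ := by
      intro x
      rcases eq_or_ne x 0 with rfl | hx
      · simp
      have hx' : 0 < ‖x‖ := norm_pos_iff.2 hx
      have := hle ((r / ‖x‖) • x) (by
        rw [norm_smul, Real.norm_of_nonneg (by positivity), div_mul_cancel₀ _ hx'.ne'])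
      rw [map_smul, smul_eq_mul] at this
      rw [div_mul_eq_mul_div, le_div_iff₀ hr]
      rw [div_mul_eq_mul_div, div_le_iff₀ hx'] at this
      linarith
    refine η.opNorm_le_bound (by positivity) fun x => ?_
    rw [Real.norm_eq_abs, abs_le]
    refine ⟨?_, hle' x⟩
    have := hle' (-x)
    rw [map_neg, norm_neg] at this
    linarith

/-! ### The costate and its extremals -/

section Costate

universe v

variable {E : Type v} [NormedAddCommGroup E] [NormedSpace ℝ E]
  {G : Type*} [TopologicalSpace G] [ChartedSpace E G] [Group G]
  {W : Type*} [NormedAddCommGroup W] [NormedSpace ℝ W]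

/-- The operation of turning an endomorphism of the Lie algebra into a covector of the control
space. -/
noncomputable def pullCovector (ι : W →L[ℝ] E) (l : E →L[ℝ] ℝ) : (E →L[ℝ] E) →L[ℝ] (W →L[ℝ] ℝ) :=
  ((ContinuousLinearMap.compL ℝ W E ℝ).flip ι).comp (ContinuousLinearMap.compL ℝ E E ℝ l)

/-- The covector `l ∘ Ad g`, restricted to the control space. -/
noncomputable def costate (ι : W →L[ℝ] E) (l : E →L[ℝ] ℝ) (g : G) : W →L[ℝ] ℝ :=
  pullCovector ι l (adModel g)

theorem costate_apply (ι : W →L[ℝ] E) (l : E →L[ℝ] ℝ) (g : G) (v : W) :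
    costate ι l g v = l (adModel g (ι v)) := rfl

variable [LieGroup 𝓘(ℝ, E) ∞ G]

theorem continuous_costate (ι : W →L[ℝ] E) (l : E →L[ℝ] ℝ) :
    Continuous (costate (G := G) ι l) :=
  (pullCovector ι l).continuous.comp contMDiff_adModel.continuous

variable {ι : W →L[ℝ] E} {l : E →L[ℝ] ℝ} {r : ℝ} {γ : ℝ → G} {w : ℝ → W}

omit [LieGroup 𝓘(ℝ, E) ∞ G] in
theorem IsDevelopment.norm_le_of_hasDerivAt (h : IsDevelopment ι r γ w) (hr : 0 ≤ r) {t : ℝ} {u : W}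
    (hu : HasDerivAt w u t) : ‖u‖ ≤ r := by
  have := hu.le_of_lipschitz h.lipschitzWith
  rwa [Real.coe_toNNReal _ hr] at this

/-- The norm is locally Lipschitz along `γ`, so it suffices that its derivative vanishes almost
everywhere. With `u = w'(t)` frozen, `r‖η(s)‖ - η(s) u` is nonnegative and vanishes at `s = t`,
while `η(s) u` has derivative zero there. -/
theorem IsDevelopment.norm_costate_eq [FiniteDimensional ℝ E] [FiniteDimensional ℝ W]
    (h : IsDevelopment ι r γ w) (hr : 0 < r)
    (hmax : ∀ t u, HasDerivAt w u t → costate ι l (γ t) u = r * ‖costate ι l (γ t)‖) (a b : ℝ) :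
    ‖costate ι l (γ a)‖ = ‖costate ι l (γ b)‖ := by
  have hloc : LocallyLipschitzOn (uIcc a b) fun t => ‖costate ι l (γ t)‖ := by
    intro t _
    obtain ⟨K, T, hT, hK⟩ := h.exists_lipschitzOnWith (t₀ := t)
      (Eventually.of_forall (contMDiff_adModel (G := G)))
    exact ⟨_, T, mem_nhdsWithin_of_mem_nhds hT,
      lipschitzWith_one_norm.comp_lipschitzOnWith ((pullCovector ι l).lipschitz.comp_lipschitzOnWith hK)⟩
  obtain ⟨K, hK⟩ := hloc.exists_lipschitzOnWith_of_compact isCompact_uIcc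
  have hac := hK.absolutelyContinuousOnInterval
  obtain ⟨C, hC⟩ := hac.const_of_ae_hasDerivAt_zero (by
    filter_upwards [hac.ae_differentiableAt, h.lipschitzWith.ae_differentiableAt_real]
      with t ht hw htm
    have ha := (ht htm).hasDerivAt
    have hu := hw.hasDerivAt
    set u := deriv w t
    have hf : HasDerivAt (fun s => costate ι l (γ s) u) 0 t := by
      have h1 := h.hasDerivAt (t₀ := t) (f := fun x => adModel (E := E) x (ι u))
        (Eventually.of_forall (contMDiff_adModel_apply (G := G) (ι u))) hu
      rw [leftDeriv_adModel_apply_self] at h1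
      exact (l.hasFDerivAt.comp_hasDerivAt t h1).congr_deriv (map_zero l)
    have hmin : IsLocalMin (fun s => r * ‖costate ι l (γ s)‖ - costate ι l (γ s) u) t := by
      refine Eventually.of_forall fun s => ?_
      simp only
      rw [hmax t u hu, sub_self, sub_nonneg]
      calc costate ι l (γ s) u ≤ ‖costate ι l (γ s) u‖ := le_abs_self _
        _ ≤ ‖costate ι l (γ s)‖ * ‖u‖ := ContinuousLinearMap.le_opNorm _ _
        _ ≤ r * ‖costate ι l (γ s)‖ := by
          rw [mul_comm]
          gcongr
          exact h.norm_le_of_hasDerivAt hr.le hu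
    have h0 := hmin.hasDerivAt_eq_zero ((ha.const_mul r).sub hf)
    rw [sub_zero, mul_eq_zero, or_iff_right hr.ne'] at h0
    rwa [h0] at ha)
  rw [hC a left_mem_uIcc, hC b right_mem_uIcc]

variable [FiniteDimensional ℝ E] [FiniteDimensional ℝ W]

-- Maximality survives although the controls need not converge: near `t` the controls of the
-- polygons almost maximise the fixed covector `η`. Integrating gives a linear lower bound on the
-- growth of `η ∘ w' n`, which passes to the limit and bounds the slope of `η ∘ w`.
omit [FiniteDimensional ℝ W] in
theorem apply_eq_of_tendsto_polygon (hr : 0 < r) {c : ℕ → ℝ → G} {w' u' : ℕ → ℝ → W}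
    (hc : ∀ n, IsControlled ι r (c n) (w' n) (u' n)) {𝓤 : Filter ℕ} [NeBot 𝓤] (h𝓤 : 𝓤 ≤ atTop)
    (hγ : ∀ t, Tendsto (fun n => c n t) 𝓤 (𝓝 (γ t)))
    (hw : ∀ t, Tendsto (fun n => w' n t) 𝓤 (𝓝 (w t)))
    (hmax : ∀ (n : ℕ) t, ∃ τ, |τ - t| ≤ 1 / ((n : ℝ) + 1) ∧
      costate ι l (c n τ) (u' n t) = r * ‖costate ι l (c n τ)‖)
    {t : ℝ} {u : W} (hu : HasDerivAt w u t) :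
    costate ι l (γ t) u = r * ‖costate ι l (γ t)‖ := by
  have hdev := isDevelopment_of_tendsto hc hγ hw
  set η := costate ι l (γ t) with hη
  refine le_antisymm ?_ ?_
  · calc η u ≤ ‖η u‖ := le_abs_self _
      _ ≤ ‖η‖ * ‖u‖ := ContinuousLinearMap.le_opNorm _ _
      _ ≤ r * ‖η‖ := by
        rw [mul_comm]
        gcongr
        exact hdev.norm_le_of_hasDerivAt hr.le hu
  · refine le_of_forall_pos_le_add fun ε' hε' => ?_
    -- Replacing `η'` by `η` costs `ε * r` twice: in the value at the control and in the norm.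
    set ε := ε' / (2 * r) with hε
    have hε0 : 0 < ε := by positivity
    have hεε : ε' = 2 * ε * r := by
      rw [hε]
      field_simp
    set m := r * ‖η‖ - 2 * ε * r with hm
    have hO : {g : G | dist (costate ι l g) η < ε} ∈ 𝓝 (γ t) :=
      (continuous_costate ι l).continuousAt (Metric.ball_mem_nhds _ hε0)
    obtain ⟨δ, hδ, hev⟩ := eventually_forall_mem_of_tendsto hc (hγ t) hO
    have hstep : ∀ᶠ n : ℕ in 𝓤, 1 / ((n : ℝ) + 1) < δ / 2 :=
      h𝓤 (tendsto_one_div_add_atTop_nhds_zero_nat.eventually_lt_const (u := δ / 2) (by positivity))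
    have hpoly : ∀ᶠ n in 𝓤, ∀ s ∈ Icc t (t + δ / 4), m * (s - t) + η (w' n t) ≤ η (w' n s) := by
      filter_upwards [hev, hstep] with n hn hn'
      refine image_le_of_deriv_right_le_deriv_boundary (f' := fun _ => m)
        (B' := fun s => η (u' n s)) (by fun_prop) (fun s _ => ?_) (by simp)
        (η.continuous.comp (hc n).continuous_primitive).continuousOn
        (fun s _ => η.hasFDerivAt.comp_hasDerivWithinAt s ((hc n).derivative s)) (fun s hs => ?_)
      · simpa using ((((hasDerivAt_id s).sub_const t).const_mul m).add_const
          (η (w' n t))).hasDerivWithinAt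
      · obtain ⟨τ, hτ, hτm⟩ := hmax n s
        have h1 : dist (costate ι l (c n τ)) η < ε := hn τ (by
          have h1 : |s - t| ≤ δ / 4 := by
            rw [abs_of_nonneg (by linarith [hs.1])]
            linarith [hs.2]
          have := abs_sub_le τ s t
          linarith)
        rw [dist_eq_norm] at h1
        set η' := costate ι l (c n τ)
        have h2 : (η' - η) (u' n s) ≤ ε * r :=
          calc (η' - η) (u' n s) ≤ ‖(η' - η) (u' n s)‖ := le_abs_self _
            _ ≤ ‖η' - η‖ * ‖u' n s‖ := ContinuousLinearMap.le_opNorm _ _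
            _ ≤ ε * r := mul_le_mul h1.le ((hc n).norm_le s) (norm_nonneg _) hε0.le
        rw [sub_apply, hτm] at h2
        have h3 : ‖η‖ ≤ ‖η'‖ + ε := by
          have := norm_le_norm_add_norm_sub η' η
          linarith
        have h4 := mul_le_mul_of_nonneg_left h3 hr.le
        simp only [hm]
        linarith
    have hlim : ∀ s ∈ Icc t (t + δ / 4), m * (s - t) + η (w t) ≤ η (w s) := by
      intro s hs
      refine le_of_tendsto_of_tendsto ((η.continuous.continuousAt.tendsto.comp (hw t)).const_add _)
        (η.continuous.continuousAt.tendsto.comp (hw s)) (hpoly.mono fun n hn => hn s hs)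
    have hd : HasDerivAt (fun s => η (w s)) (η u) t := η.hasFDerivAt.comp_hasDerivAt t hu
    have hslope := hd.hasDerivWithinAt (s := Ioi t)
    rw [hasDerivWithinAt_iff_tendsto_slope' (by simp)] at hslope
    have : m ≤ η u := by
      refine ge_of_tendsto hslope ?_
      filter_upwards [Ioc_mem_nhdsGT (show t < t + δ / 4 by linarith)] with s hs
      rw [slope_def_field, le_div_iff₀ (by linarith [hs.1])]
      linarith [hlim s ⟨hs.1.le, hs.2⟩]
    linarith

variable (ι l) in
/-- Existence of a global extremal for the problem of maximising the covector over the ball of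
radius `r`, which follows the one-parameter subgroup of `Y` as long as `Y` is a maximiser. -/
theorem exists_isDevelopment_maximizing (hr : 0 < r) {Y : W} (hYr : ‖Y‖ ≤ r) {T : ℝ}
    (hY : ∀ t ∈ Icc 0 T, costate ι l (expLine G (ι Y) t) Y
      = r * ‖costate ι l (expLine G (ι Y) t)‖) :
    ∃ (γ : ℝ → G) (w : ℝ → W), IsDevelopment ι r γ w ∧ γ 0 = 1 ∧
      (∀ t ∈ Icc 0 T, γ t = expLine G (ι Y) t) ∧
      ∀ t u, HasDerivAt w u t → costate ι l (γ t) u = r * ‖costate ι l (γ t)‖ := by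
  have : IsTopologicalGroup G := topologicalGroup_of_lieGroup 𝓘(ℝ, E) ∞
  have : T1Space G := ChartedSpace.t1Space E G
  have : T2Space G := inferInstance
  -- Ties are broken in favour of `Y`, which keeps the polygons on `exp(tY)`. No regularity of the
  -- selection is needed.
  have hsel : ∀ g : G, ∃ v : W, ‖v‖ ≤ r ∧ costate ι l g v = r * ‖costate ι l g‖ ∧
      (costate ι l g Y = r * ‖costate ι l g‖ → v = Y) := by
    intro g
    by_cases h : costate ι l g Y = r * ‖costate ι l g‖
    · exact ⟨Y, hYr, h, fun _ => rfl⟩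
    · obtain ⟨v, hv, hv'⟩ := exists_norm_le_and_apply_eq hr (costate ι l g)
      exact ⟨v, hv, hv', fun h' => absurd h' h⟩
  choose σ hσr hσ hσY using hsel
  have hpoly := fun n : ℕ => exists_isControlled_of_feedback ι hσr
    (show (0 : ℝ) < 1 / ((n : ℝ) + 1) by positivity)
  choose c w' u' hc hc0 hw0 hu hcY using hpoly
  obtain ⟨γ, w, hlim⟩ := exists_tendsto_hyperfilter hc hc0 hw0
  have hγ := fun t => (hlim t).1
  have hw := fun t => (hlim t).2
  refine ⟨γ, w, isDevelopment_of_tendsto hc hγ hw, ?_, fun t ht => ?_, fun t u hu' => ?_⟩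
  · exact tendsto_nhds_unique (hγ 0) (by simp [hc0])
  · refine tendsto_nhds_unique (hγ t) (tendsto_const_nhds.congr fun n => ?_)
    exact (hcY n Y T (fun s hs => hσY _ (hY s hs)) t ht).symm
  · refine apply_eq_of_tendsto_polygon hr hc (Nat.hyperfilter_le_atTop) hγ hw (fun n t => ?_) hu'
    obtain ⟨τ, hτ, hτu⟩ := hu n t
    exact ⟨τ, hτ, by rw [hτu]; exact hσ _⟩

end Costate

/-! ### Left translation and time shift of extremals -/

section Translate

universe v

variable {E : Type v} [NormedAddCommGroup E] [NormedSpace ℝ E]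
  {G : Type*} [TopologicalSpace G] [ChartedSpace E G] [Group G] [LieGroup 𝓘(ℝ, E) ∞ G]
  {W : Type*} [NormedAddCommGroup W] [NormedSpace ℝ W]

theorem IsDevelopment.translate {ι : W →L[ℝ] E} {r : ℝ} {γ : ℝ → G} {w : ℝ → W}
    (h : IsDevelopment ι r γ w) (g : G) (β : ℝ) :
    IsDevelopment ι r (fun t => g * γ (t + β)) (fun t => w (t + β)) := by
  have : IsTopologicalGroup G := topologicalGroup_of_lieGroup 𝓘(ℝ, E) ∞
  refine ⟨continuous_const.mul (h.continuous.comp (continuous_id.add continuous_const)),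
    fun s t => ?_, fun F _ _ f t₀ hf ε hε => ?_⟩
  · simpa using h.norm_sub_le (s + β) (t + β)
  · have hf' : ∀ᶠ x in 𝓝 (γ (t₀ + β)), ContMDiffAt 𝓘(ℝ, E) 𝓘(ℝ, F) ∞ (fun y => f (g * y)) x := by
      filter_upwards [(continuous_const_mul g).continuousAt.eventually hf] with x hx
      exact ContMDiffAt.comp x hx contMDiff_mul_left.contMDiffAt
    obtain ⟨δ, hδ, H⟩ := h.strict F _ (t₀ + β) hf' ε hε
    refine ⟨δ, hδ, fun s t hs ht => ?_⟩
    have := H (s + β) (t + β) (by simpa using hs) (by simpa using ht)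
    rw [leftDeriv_comp_mul_left] at this
    simpa using this

theorem costate_comp_adModel_inv_mul (ι : W →L[ℝ] E) (l : E →L[ℝ] ℝ) (g x : G) :
    costate ι (l.comp (adModel g⁻¹)) (g * x) = costate ι l x := by
  ext v
  rw [costate_apply, costate_apply, ContinuousLinearMap.comp_apply, ← ContinuousLinearMap.comp_apply
    (adModel g⁻¹), ← adModel_mul, inv_mul_cancel_left]

end Translate

/-! ### The normed control space, faces of the dual ball and normality -/

namespace SubFinsler

variable {E : Type*} [NormedAddCommGroup E] [NormedSpace ℝ E] [FiniteDimensional ℝ E]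
  {G : Type*} [TopologicalSpace G] [ChartedSpace E G] [Group G] [LieGroup 𝓘(ℝ, E) ∞ G]

/-- The polarization, as a normed space with the sub-Finsler norm. -/
def ControlSpace (S : SubFinsler E G) : Type _ := S.V

variable (S : SubFinsler E G)

noncomputable instance : AddCommGroup S.ControlSpace := inferInstanceAs (AddCommGroup S.V)

noncomputable instance : Module ℝ S.ControlSpace := inferInstanceAs (Module ℝ S.V)

noncomputable instance : Norm S.ControlSpace := ⟨fun v => S.norm v⟩

theorem controlSpace_core : NormedSpace.Core ℝ S.ControlSpace where
  norm_nonneg v := apply_nonneg S.norm v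
  norm_smul c v := map_smul_eq_mul S.norm c v
  norm_triangle v w := map_add_le_add S.norm v w
  norm_eq_zero_iff v := ⟨fun h => S.eq_zero_of_norm_eq_zero v h, fun h => by
    rw [h]
    exact map_zero S.norm⟩

noncomputable instance : NormedAddCommGroup S.ControlSpace := .ofCore S.controlSpace_core

noncomputable instance : NormedSpace ℝ S.ControlSpace := .ofCore S.controlSpace_core

instance : FiniteDimensional ℝ (GroupLieAlgebra 𝓘(ℝ, E) G) := inferInstanceAs (FiniteDimensional ℝ E)

instance : T2Space (GroupLieAlgebra 𝓘(ℝ, E) G) := inferInstanceAs (T2Space E)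

instance : FiniteDimensional ℝ S.ControlSpace := inferInstanceAs (FiniteDimensional ℝ S.V)

/-- The identification of the normed control space with the polarization. -/
noncomputable def controlEquiv : S.ControlSpace ≃L[ℝ] S.V :=
  LinearEquiv.toContinuousLinearEquiv (LinearEquiv.refl ℝ S.V : S.ControlSpace ≃ₗ[ℝ] S.V)

/-- The inclusion of the control space in the model space of the Lie algebra. -/
noncomputable def inclusion : S.ControlSpace →L[ℝ] E :=
  S.V.subtypeL.comp (S.controlEquiv : S.ControlSpace →L[ℝ] S.V)

end SubFinsler

namespace SubFinsler

variable {E : Type*} [NormedAddCommGroup E] [NormedSpace ℝ E] [FiniteDimensional ℝ E]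
  {G : Type*} [TopologicalSpace G] [ChartedSpace E G] [Group G] [LieGroup 𝓘(ℝ, E) ∞ G]
  (S : SubFinsler E G)

theorem norm_controlEquiv (v : S.ControlSpace) : S.norm (S.controlEquiv v) = ‖v‖ := rfl

theorem norm_controlEquiv_symm (v : S.V) : ‖S.controlEquiv.symm v‖ = S.norm v := rfl

theorem dualNorm_comp_controlEquiv_symm [Nontrivial S.ControlSpace] (ξ : S.ControlSpace →L[ℝ] ℝ) :
    dualNorm S.norm (ξ.comp (S.controlEquiv.symm : S.V →L[ℝ] S.ControlSpace)) = ‖ξ‖ := by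
  refine IsGreatest.csSup_eq ⟨?_, ?_⟩
  · obtain ⟨v, hv, hv'⟩ := exists_norm_le_and_apply_eq one_pos ξ
    rw [one_mul] at hv'
    rcases hv.lt_or_eq with h | h
    -- A maximiser inside the open ball forces `ξ = 0`; then any unit vector attains the supremum.
    · have h0 : ‖ξ‖ = 0 := by
        have h1 : ‖ξ‖ ≤ ‖ξ‖ * ‖v‖ := hv'.symm.le.trans ((le_abs_self _).trans (ξ.le_opNorm v))
        by_contra h0
        have h2 : 0 < ‖ξ‖ := lt_of_le_of_ne (norm_nonneg _) (Ne.symm h0)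
        nlinarith
      obtain ⟨y, hy⟩ := exists_norm_eq S.ControlSpace zero_le_one
      refine ⟨S.controlEquiv y, by rw [norm_controlEquiv, hy], ?_⟩
      rw [h0, norm_eq_zero.1 h0]
      rfl
    · exact ⟨S.controlEquiv v, by rw [norm_controlEquiv, h], by simpa using hv'⟩
  · rintro _ ⟨v, hv, rfl⟩
    calc ξ (S.controlEquiv.symm v) ≤ ‖ξ (S.controlEquiv.symm v)‖ := le_abs_self _
      _ ≤ ‖ξ‖ * ‖S.controlEquiv.symm v‖ := ξ.le_opNorm _
      _ = ‖ξ‖ := by rw [norm_controlEquiv_symm, hv, mul_one]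

/-- Attaining the norm at `Y` is invariant under positive scaling of the covector. So a relatively
open piece of the sphere yields an open set of covectors in the whole dual. -/
theorem exists_eventually_apply_eq_norm {Y : S.V} (hY0 : Y ≠ 0)
    (hY : (interiorInDualSphere S.norm (S.norm Y)
      (subdifferential (energy S.norm) Y)).Nonempty) :
    ∃ ξ₀ : S.ControlSpace →L[ℝ] ℝ, ξ₀ ≠ 0 ∧ ∀ᶠ ξ in 𝓝 ξ₀,
      ξ (S.controlEquiv.symm Y) = S.norm Y * ‖ξ‖ := by
  set r := S.norm Y with hr
  set y := S.controlEquiv.symm Y with hy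
  have hyr : ‖y‖ = r := rfl
  have hr0 : 0 < r := lt_of_le_of_ne (apply_nonneg _ _)
    fun h => hY0 (S.eq_zero_of_norm_eq_zero Y h.symm)
  have : Nontrivial S.ControlSpace := ⟨y, 0, fun h => by rw [h, norm_zero] at hyr; exact hr0.ne hyr⟩
  obtain ⟨⟨p, hp⟩, hpi⟩ := hY
  set Φ : (S.ControlSpace →L[ℝ] ℝ) →L[ℝ] (S.V →L[ℝ] ℝ) := ContinuousLinearMap.precomp ℝ (S.controlEquiv.symm : S.V →L[ℝ] S.ControlSpace) with hΦ
  have hΦa : ∀ ξ, Φ ξ = ξ.comp (S.controlEquiv.symm : S.V →L[ℝ] S.ControlSpace) := fun ξ => rfl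
  set ξ₀ : S.ControlSpace →L[ℝ] ℝ := p.comp (S.controlEquiv : S.ControlSpace →L[ℝ] S.V) with hξ₀
  have hΦξ₀ : Φ ξ₀ = p := by
    ext v
    simp [hΦa, hξ₀]
  have hnorm : ‖ξ₀‖ = r := by
    rw [← S.dualNorm_comp_controlEquiv_symm, ← hΦa, hΦξ₀]
    exact hp
  have hξ₀0 : ξ₀ ≠ 0 := by
    rw [← norm_ne_zero_iff, hnorm]
    exact hr0.ne'
  obtain ⟨O, hO, hOsub⟩ := (mem_nhds_subtype _ _ _).1 (mem_interior_iff_mem_nhds.1 hpi)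
  have hface : ∀ᶠ ξ in 𝓝 ξ₀, ‖ξ‖ = r → ξ y = r * r := by
    have hO' : ∀ᶠ ξ in 𝓝 ξ₀, Φ ξ ∈ O := by
      refine Φ.continuous.continuousAt.eventually ?_
      rwa [hΦξ₀]
    filter_upwards [hO'] with ξ hξ hξr
    have hmem : Φ ξ ∈ dualSphere S.norm r := by
      change dualNorm S.norm (Φ ξ) = r
      rw [hΦa, dualNorm_comp_controlEquiv_symm, hξr]
    have hsub : Φ ξ ∈ subdifferential (energy S.norm) Y := hOsub (a := ⟨Φ ξ, hmem⟩) hξ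
    obtain ⟨v, hv, hv'⟩ := exists_norm_le_and_apply_eq hr0 ξ
    -- The subgradient inequality is tested at a maximiser `v` of `ξ`; as `‖v‖ ≤ r`, it forces `ξ y
    -- ≥ ξ v`.
    have h1 : ξ (v - y) ≤ 1 / 2 * ‖v‖ ^ 2 - 1 / 2 * r ^ 2 := hsub (S.controlEquiv v)
    rw [map_sub, hv', hξr] at h1
    have h2 : ‖v‖ ^ 2 ≤ r ^ 2 := by gcongr
    refine le_antisymm ?_ (by linarith)
    calc ξ y ≤ ‖ξ y‖ := le_abs_self _
      _ ≤ ‖ξ‖ * ‖y‖ := ξ.le_opNorm y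
      _ = r * r := by rw [hξr, hyr]
  refine ⟨ξ₀, hξ₀0, ?_⟩
  have hscale : Tendsto (fun ξ : S.ControlSpace →L[ℝ] ℝ => (r / ‖ξ‖) • ξ) (𝓝 ξ₀) (𝓝 ξ₀) := by
    have h1 : ContinuousAt (fun ξ : S.ControlSpace →L[ℝ] ℝ => (r / ‖ξ‖) • ξ) ξ₀ :=
      (continuousAt_const.div continuous_norm.continuousAt (norm_ne_zero_iff.2 hξ₀0)).smul
        continuousAt_id
    have h2 : (r / ‖ξ₀‖) • ξ₀ = ξ₀ := by rw [hnorm, div_self hr0.ne', one_smul]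
    have h3 := h1.tendsto
    rwa [h2] at h3
  filter_upwards [hscale.eventually hface, isOpen_ne.mem_nhds hξ₀0] with ξ hξ hξ0
  have hpos : 0 < ‖ξ‖ := norm_pos_iff.2 hξ0
  have h1 := hξ (by rw [norm_smul, Real.norm_of_nonneg (by positivity), div_mul_cancel₀ _ hpos.ne'])
  have h2 : r / ‖ξ‖ * ξ y = r * r := h1
  rw [div_mul_eq_mul_div, div_eq_iff hpos.ne'] at h2
  have h3 : r * ξ y = r * (r * ‖ξ‖) := by rw [h2]; ring
  exact mul_left_cancel₀ hr0.ne' h3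

/-- The control is `deriv w`, which exists almost everywhere and is bounded by `r`. The subgradient
inequality reduces to `r‖v‖ ≤ (r² + ‖v‖²) / 2`. -/
theorem isNormalCurve_of_isDevelopment {l : E →L[ℝ] ℝ} {r : ℝ} {γ : ℝ → G}
    {w : ℝ → S.ControlSpace} (h : IsDevelopment S.inclusion r γ w) (hr : 0 ≤ r)
    (hmax : ∀ t u, HasDerivAt w u t → costate S.inclusion l (γ t) u = r * r)
    (hnorm : ∀ t, ‖costate S.inclusion l (γ t)‖ = r) : S.IsNormalCurve γ univ := by
  have hlip := h.lipschitzWith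
  have hderiv : ∀ t, ‖deriv w t‖ ≤ r := fun t => by
    have := norm_deriv_le_of_lipschitz (x₀ := t) hlip
    rwa [Real.coe_toNNReal _ hr] at this
  have hdiff := hlip.ae_differentiableAt_real
  have : ProperSpace S.ControlSpace := FiniteDimensional.proper ℝ _
  have hmeas : StronglyMeasurable (deriv w) := stronglyMeasurable_deriv w
  refine ⟨fun t => S.controlEquiv (deriv w t), ⟨h.isAbsolutelyContinuousCurve univ, ?_⟩,
    fun a b => ⟨?_, ?_⟩, l, ?_⟩
  · rw [Measure.restrict_univ]
    filter_upwards [hdiff] with t ht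
    exact h.hasLeftVelocityWithinAt ht.hasDerivAt univ
  · exact (S.controlEquiv.continuous.comp_stronglyMeasurable hmeas).aestronglyMeasurable
  · rw [univ_inter]
    refine MemLp.of_bound hmeas.norm.aestronglyMeasurable r (Eventually.of_forall fun t => ?_)
    change ‖‖deriv w t‖‖ ≤ r
    rw [norm_norm]
    exact hderiv t
  · rw [Measure.restrict_univ]
    filter_upwards [hdiff] with t ht v
    set u := deriv w t with hu
    set η := costate S.inclusion l (γ t) with hη
    set v' := S.controlEquiv.symm v with hv'
    have h1 : η (v' - u) ≤ 1 / 2 * ‖v'‖ ^ 2 - 1 / 2 * ‖u‖ ^ 2 := by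
      have h2 : η v' ≤ r * ‖v'‖ :=
        calc η v' ≤ ‖η v'‖ := le_abs_self _
          _ ≤ ‖η‖ * ‖v'‖ := η.le_opNorm _
          _ = r * ‖v'‖ := by rw [hnorm]
      have h3 : ‖u‖ ^ 2 ≤ r ^ 2 := by
        gcongr
        exact hderiv t
      rw [map_sub, hmax t u ht.hasDerivAt]
      nlinarith [sq_nonneg (r - ‖v'‖)]
    exact h1

end SubFinsler

/-! ### Choice of the covector and the extremal that leaves `exp(tY)` -/

theorem exists_unbounded_apply {E : Type*} [NormedAddCommGroup E] [NormedSpace ℝ E]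
    [FiniteDimensional ℝ E] {α : Type*} {f : α → E} (hf : ¬ Bornology.IsVonNBounded ℝ (range f)) :
    ∃ l : E →L[ℝ] ℝ, ¬ ∃ C, ∀ t, |l (f t)| ≤ C := by
  by_contra! hcon
  refine hf ((NormedSpace.isVonNBounded_iff ℝ).2 ?_)
  let b := Module.finBasis ℝ E
  choose C hC using fun i => hcon (LinearMap.toContinuousLinearMap (b.coord i))
  refine isBounded_iff_forall_norm_le.2 ⟨∑ i, C i * ‖b i‖, ?_⟩
  rintro _ ⟨t, rfl⟩
  calc ‖f t‖ = ‖∑ i, b.repr (f t) i • b i‖ := by rw [b.sum_repr]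
    _ ≤ ∑ i, ‖b.repr (f t) i • b i‖ := norm_sum_le _ _
    _ ≤ ∑ i, C i * ‖b i‖ := by
      refine Finset.sum_le_sum fun i _ => ?_
      rw [norm_smul]
      exact mul_le_mul_of_nonneg_right (hC i t) (norm_nonneg _)

/-- If `l₀` is bounded along `f`, then `l₀ + ε μ` is unbounded for every `ε ≠ 0`, and small `ε`
preserves `P`. -/
theorem exists_covector_near {E : Type*} [NormedAddCommGroup E] [NormedSpace ℝ E]
    {W : Type*} [NormedAddCommGroup W] [NormedSpace ℝ W] {α : Type*} {f : α → E}
    {μ : E →L[ℝ] ℝ} (hμ : ¬ ∃ C, ∀ t, |μ (f t)| ≤ C) (l₀ : E →L[ℝ] ℝ) (ι : W →L[ℝ] E)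
    {P : (W →L[ℝ] ℝ) → Prop} (hP : ∀ᶠ ξ in 𝓝 (l₀.comp ι), P ξ) :
    ∃ l : E →L[ℝ] ℝ, (¬ ∃ C, ∀ t, |l (f t)| ≤ C) ∧ P (l.comp ι) := by
  by_cases h : ∃ C, ∀ t, |l₀ (f t)| ≤ C
  · have hlim : Tendsto (fun ε : ℝ => (l₀ + ε • μ).comp ι) (𝓝[≠] 0) (𝓝 (l₀.comp ι)) := by
      have h1 : Continuous fun ε : ℝ => (l₀ + ε • μ).comp ι := by fun_prop
      have h2 := h1.tendsto 0
      simp only [zero_smul, add_zero] at h2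
      exact h2.mono_left nhdsWithin_le_nhds
    obtain ⟨ε, hε, hε0⟩ := ((hlim.eventually hP).and self_mem_nhdsWithin).exists
    refine ⟨l₀ + ε • μ, ?_, hε⟩
    rintro ⟨C', hC'⟩
    obtain ⟨C, hC⟩ := h
    refine hμ ⟨(C' + C) / |ε|, fun t => ?_⟩
    rw [le_div_iff₀ (abs_pos.2 hε0), mul_comm, ← abs_mul]
    have h1 : ε * μ (f t) = (l₀ + ε • μ) (f t) - l₀ (f t) := by simp
    rw [h1]
    exact (abs_sub _ _).trans (add_le_add (hC' t) (hC t))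
  · exact ⟨l₀, h, hP.self_of_nhds⟩

namespace SubFinsler

variable {E : Type*} [NormedAddCommGroup E] [NormedSpace ℝ E] [FiniteDimensional ℝ E]
  {G : Type*} [TopologicalSpace G] [ChartedSpace E G] [Group G] [LieGroup 𝓘(ℝ, E) ∞ G]
  (S : SubFinsler E G)

theorem ne_zero_of_not_isVonNBounded {Y X : S.V}
    (hX : ¬ Bornology.IsVonNBounded ℝ
      (range fun t : ℝ => Ad (lieExp (t • (Y : GroupLieAlgebra 𝓘(ℝ, E) G)))
        (X : GroupLieAlgebra 𝓘(ℝ, E) G))) : Y ≠ 0 := by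
  rintro rfl
  refine hX ?_
  have h : ∀ t : ℝ, lieExp (t • ((0 : S.V) : GroupLieAlgebra 𝓘(ℝ, E) G)) = (1 : G) := by
    intro t
    have h0 : t • ((0 : S.V) : GroupLieAlgebra 𝓘(ℝ, E) G)
        = (0 : ℝ) • ((0 : S.V) : GroupLieAlgebra 𝓘(ℝ, E) G) := by simp
    rw [h0]
    exact expLine_zero (G := G) (0 : E)
  simp only [h]
  have hsub : range (fun _ : ℝ => Ad (1 : G) (X : GroupLieAlgebra 𝓘(ℝ, E) G))
      ⊆ {Ad (1 : G) (X : GroupLieAlgebra 𝓘(ℝ, E) G)} := by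
    rintro _ ⟨t, rfl⟩
    rfl
  exact (Bornology.isVonNBounded_singleton _).subset hsub

/-- Under the assumptions of the branching theorem there is a development of a maximal control
which leaves the one-parameter subgroup generated by `Y` after having followed it for some time. -/
theorem exists_extremal_leaving_expLine {Y X : S.V}
    (hY : (interiorInDualSphere S.norm (S.norm Y)
      (subdifferential (energy S.norm) Y)).Nonempty)
    (hX : ¬ Bornology.IsVonNBounded ℝ
      (range fun t : ℝ => Ad (lieExp (t • (Y : GroupLieAlgebra 𝓘(ℝ, E) G)))
        (X : GroupLieAlgebra 𝓘(ℝ, E) G))) :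
    ∃ (l : E →L[ℝ] ℝ) (γ : ℝ → G) (w : ℝ → S.ControlSpace) (T : ℝ),
      0 < T ∧ IsDevelopment S.inclusion (S.norm Y) γ w ∧
      (∀ t u, HasDerivAt w u t → costate S.inclusion l (γ t) u = S.norm Y * S.norm Y) ∧
      (∀ t, ‖costate S.inclusion l (γ t)‖ = S.norm Y) ∧
      (∀ t ∈ Icc 0 T, γ t = expLine G (S.inclusion (S.controlEquiv.symm Y)) t) ∧
      ∃ t, γ t ≠ expLine G (S.inclusion (S.controlEquiv.symm Y)) t := by
  have hY0 := S.ne_zero_of_not_isVonNBounded hX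
  set r := S.norm Y with hr
  have hr0 : 0 < r := lt_of_le_of_ne (apply_nonneg _ _)
    fun h => hY0 (S.eq_zero_of_norm_eq_zero Y h.symm)
  set y := S.controlEquiv.symm Y with hy
  set x := S.controlEquiv.symm X with hx
  set ι := S.inclusion with hι
  set f : ℝ → E := fun t => adModel (expLine G (ι y) t) (ι x) with hf
  obtain ⟨μ, hμ⟩ := exists_unbounded_apply (f := f) hX
  obtain ⟨ξ₀, hξ₀, hev⟩ := S.exists_eventually_apply_eq_norm hY0 hY
  obtain ⟨l₀, hl₀⟩ : ∃ l₀ : E →L[ℝ] ℝ, l₀.comp ι = ξ₀ := by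
    let V' : Submodule ℝ E := S.V
    obtain ⟨g, hg⟩ := LinearMap.exists_extend (p := V')
      (ξ₀.toLinearMap ∘ₗ (S.controlEquiv.symm.toLinearEquiv : S.V →ₗ[ℝ] S.ControlSpace))
    refine ⟨LinearMap.toContinuousLinearMap g, ?_⟩
    ext v
    have h1 := congrArg (fun φ => φ (S.controlEquiv v)) hg
    exact h1
  -- The nested neighbourhood leaves room twice: for perturbing `l₀` to `l₁`, and for the costate of
  -- `l₁` to move along `exp(tY)` during a positive time.
  have hP : ∀ᶠ ξ in 𝓝 (l₀.comp ι), (∀ᶠ ξ' in 𝓝 ξ, ξ' y = r * ‖ξ'‖) ∧ ξ ≠ 0 := by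
    rw [hl₀]
    exact (eventually_eventually_nhds.2 hev).and (isOpen_ne.mem_nhds hξ₀)
  obtain ⟨l₁, hl₁, hev₁, hne⟩ := exists_covector_near hμ l₀ ι hP
  have hρ : 0 < ‖l₁.comp ι‖ := norm_pos_iff.2 hne
  have hcostate_one : costate ι l₁ (1 : G) = l₁.comp ι := by
    ext v
    rw [costate_apply, adModel_one]
    rfl
  obtain ⟨T, hT, hTface⟩ : ∃ T > 0, ∀ t ∈ Icc 0 T,
      costate ι l₁ (expLine G (ι y) t) y = r * ‖costate ι l₁ (expLine G (ι y) t)‖ := by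
    have hcont : Tendsto (fun t => costate ι l₁ (expLine G (ι y) t)) (𝓝 0) (𝓝 (l₁.comp ι)) := by
      have := ((continuous_costate (G := G) ι l₁).comp (continuous_expLine (ι y))).tendsto 0
      rwa [Function.comp_apply, expLine_zero, hcostate_one] at this
    obtain ⟨δ, hδ, H⟩ := Metric.eventually_nhds_iff.1 (hcont.eventually hev₁)
    refine ⟨δ / 2, half_pos hδ, fun t ht => H ?_⟩
    rw [Real.dist_eq, sub_zero, abs_of_nonneg ht.1]
    linarith [ht.2]
  obtain ⟨γ, w, hdev, hγ0, hγY, hmax⟩ := exists_isDevelopment_maximizing ι l₁ hr0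
    (show ‖y‖ ≤ r from le_rfl) hTface
  have hnorm : ∀ t, ‖costate ι l₁ (γ t)‖ = ‖l₁.comp ι‖ := by
    intro t
    rw [hdev.norm_costate_eq hr0 hmax t 0, hγ0, hcostate_one]
  -- Maximality fixes the covector only up to scale; normality needs costate norm `r`.
  set κ := r / ‖l₁.comp ι‖ with hκ
  have hκ0 : 0 < κ := by positivity
  have hcostate : ∀ g : G, costate ι (κ • l₁) g = κ • costate ι l₁ g := fun g => rfl
  refine ⟨κ • l₁, γ, w, T, hT, hdev, fun t u hu => ?_, fun t => ?_, hγY, ?_⟩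
  · rw [hcostate, smul_apply, hmax t u hu, hnorm, smul_eq_mul, hκ]
    field_simp
  · rw [hcostate, norm_smul, hnorm, Real.norm_of_nonneg hκ0.le, hκ, div_mul_cancel₀ _ hρ.ne']
  · by_contra! hcon
    -- If `γ` never left the line, the constant norm of its costate would bound `l₁ (f t)`.
    refine hl₁ ⟨‖l₁.comp ι‖ * ‖x‖, fun t => ?_⟩
    have h1 : l₁ (f t) = costate ι l₁ (γ t) x := by
      rw [hcon t]
      rfl
    rw [h1, ← hnorm t]
    exact (costate ι l₁ (γ t)).le_opNorm x

end SubFinsler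

/-! ### The translates are pairwise different -/

section Periodicity

variable {E : Type*} [NormedAddCommGroup E] [NormedSpace ℝ E] [FiniteDimensional ℝ E]
  {G : Type*} [TopologicalSpace G] [ChartedSpace E G] [Group G] [LieGroup 𝓘(ℝ, E) ∞ G]

theorem expLine_neg (Y : E) (t : ℝ) : expLine G Y (-t) = (expLine G Y t)⁻¹ := by
  rw [eq_inv_iff_mul_eq_one, ← expLine_add, neg_add_cancel, expLine_zero]

theorem injOn_translates_of_leaving_expLine {Y : E} {γ : ℝ → G} {T : ℝ}
    (hγ : ∀ t ∈ Icc 0 T, γ t = expLine G Y t) (hleave : ∃ t, γ t ≠ expLine G Y t) :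
    InjOn (fun β t => expLine G Y (-β) * γ (t + β)) (Ico 0 T) := by
  intro β hβ β' hβ' heq
  by_contra hne
  wlog hlt : β < β' generalizing β β'
  · exact this hβ' hβ heq.symm (Ne.symm hne) (lt_of_le_of_ne (not_lt.1 hlt) (Ne.symm hne))
  obtain ⟨t, ht⟩ := hleave
  have hper : Function.Periodic (fun s => expLine G Y (-s) * γ s) (β' - β) := by
    intro s
    have h1 : expLine G Y (-β) * γ (s - β + β) = expLine G Y (-β') * γ (s - β + β') :=
      congrFun heq (s - β)
    rw [sub_add_cancel] at h1
    have h2 : -(s + (β' - β)) = -(s - β) + -β' := by ring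
    have h3 : -s = -(s - β) + -β := by ring
    have h4 : s + (β' - β) = s - β + β' := by ring
    simp only
    rw [h2, h3, h4, expLine_add, expLine_add, mul_assoc, mul_assoc, h1]
  -- The period is less than `T`, so every time has a representative where `γ` still follows the
  -- line.
  obtain ⟨s, hs, hts⟩ := hper.exists_mem_Ico₀ (sub_pos.2 hlt) t
  have hsT : s ∈ Icc 0 T := ⟨hs.1, by linarith [hs.2, hβ.1, hβ'.2]⟩
  refine ht ?_
  simp only [hγ s hsT, expLine_neg, inv_mul_cancel] at hts
  exact (inv_mul_eq_one.1 hts).symm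

end Periodicity

end SubFinslerLie

theorem mainTheorem3
    {E : Type*} [NormedAddCommGroup E] [NormedSpace ℝ E] [FiniteDimensional ℝ E]
    {G : Type*} [TopologicalSpace G] [ChartedSpace E G] [Group G] [LieGroup 𝓘(ℝ, E) ∞ G]
    (S : SubFinslerLie.SubFinsler E G) (Y X : S.V)
    (hY : (SubFinslerLie.interiorInDualSphere S.norm (S.norm Y)
      (SubFinslerLie.subdifferential (SubFinslerLie.energy S.norm) Y)).Nonempty)
    (hX : ¬ Bornology.IsVonNBounded ℝ
      (range fun t : ℝ =>
        SubFinslerLie.Ad (SubFinslerLie.lieExp (t • (Y : GroupLieAlgebra 𝓘(ℝ, E) G)))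
          (X : GroupLieAlgebra 𝓘(ℝ, E) G))) :
    S.HasBranchingOfNormalCurves ∧
      ∃ (T : ℝ) (Γ : ℝ → ℝ → G), 0 < T ∧ InjOn Γ (Ico 0 T) ∧
        ∀ β ∈ Ico 0 T, S.IsNormalCurve (Γ β) univ ∧
          ∀ t ∈ Icc 0 (T - β),
            Γ β t = SubFinslerLie.lieExp (t • (Y : GroupLieAlgebra 𝓘(ℝ, E) G)) := by
  suffices h : ∃ (T : ℝ) (Γ : ℝ → ℝ → G), 0 < T ∧ InjOn Γ (Ico 0 T) ∧
      ∀ β ∈ Ico 0 T, S.IsNormalCurve (Γ β) univ ∧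
        ∀ t ∈ Icc 0 (T - β),
          Γ β t = SubFinslerLie.lieExp (t • (Y : GroupLieAlgebra 𝓘(ℝ, E) G)) by
    refine ⟨?_, h⟩
    obtain ⟨T, Γ, hT, hinj, hΓ⟩ := h
    have h0 : (0 : ℝ) ∈ Ico 0 T := ⟨le_rfl, hT⟩
    have h1 : T / 2 ∈ Ico 0 T := ⟨by linarith, by linarith⟩
    refine ⟨univ, Icc 0 (T / 2), Γ 0, Γ (T / 2), ordConnected_univ, ordConnected_Icc,
      (Icc_infinite (by linarith)).nontrivial, subset_univ _, (hΓ 0 h0).1, (hΓ _ h1).1, fun t ht => ?_,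
      fun heq => ?_⟩
    · rw [(hΓ 0 h0).2 t ⟨ht.1, by linarith [ht.2]⟩, (hΓ _ h1).2 t ⟨ht.1, by linarith [ht.2]⟩]
    · have := hinj h0 h1 (funext fun t => heq (mem_univ t))
      linarith
  obtain ⟨l, γ, w, T, hT, hdev, hmax, hnorm, hγY, hleave⟩ :=
    S.exists_extremal_leaving_expLine hY hX
  have hr : 0 ≤ S.norm Y := apply_nonneg _ _
  let e : ℝ → G := SubFinslerLie.expLine G (S.inclusion (S.controlEquiv.symm Y))
  refine ⟨T, fun β t => e (-β) * γ (t + β), hT,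
    SubFinslerLie.injOn_translates_of_leaving_expLine hγY hleave, fun β hβ => ⟨?_, fun t ht => ?_⟩⟩
  -- Precomposing `l` with the inverse adjoint map cancels the left translation, so the costate of
  -- the translate is that of `γ`, shifted in time.
  · refine S.isNormalCurve_of_isDevelopment
      (l := l.comp (SubFinslerLie.adModel (e (-β))⁻¹)) (hdev.translate (e (-β)) β) hr
      (fun t u hu => ?_) fun t => ?_
    · rw [SubFinslerLie.costate_comp_adModel_inv_mul]
      refine hmax (t + β) u ?_
      have h1 := HasDerivAt.comp_sub_const (t + β) β (f := fun s => w (s + β)) (f' := u)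
        (by rwa [add_sub_cancel_right])
      simpa using h1
    · rw [SubFinslerLie.costate_comp_adModel_inv_mul, hnorm]
  · have h1 := hγY (t + β) ⟨by linarith [ht.1, hβ.1], by linarith [ht.2]⟩
    change e (-β) * γ (t + β) = e t
    rw [h1, ← SubFinslerLie.expLine_add]
    congr 1
    ring
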